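/- Let $(\Omega,\mathcal F,\mathbb P)$ be a probability space and let the process $(X_k)_{k\in\mathbb Z}$ and the filtration $(\mathcal F_k)_{k\in\mathbb Z}$ be given in one of the following two ways. (a) $(\xi_k)_{k\in\mathbb Z}$ is a stationary Markov chain on $\Omega$ with values in a measurable space $S$, with transition kernel $Q$ and marginal law $\pi$; $X_k=f(\xi_k)$, where $f:S\to\mathbb R$ satisfies $\int f^2\,d\pi<\infty$ and $\int f\,d\pi=0$; and $\mathcal F_k=\sigma(\xi_i,\ i\le k)$. (b) $T:\Omega\to\Omega$ is a bijective, bi-measurable, $\mathbb P$-preserving transformation, $\mathcal F_0\subseteq\mathcal F$ is a $\sigma$-algebra with $\mathcal F_0\subseteq T^{-1}(\mathcal F_0)$, $X_0$ is $\mathcal F_0$-measurable, square integrable and centered; $X_k=X_0\circ T^k$ and $\mathcal F_k=T^{-k}(\mathcal F_0)$. Put $S_n=\sum_{i=0}^{n-1}X_i$, $\mathbb E_0(\cdot)=\mathbb E(\cdot\mid\mathcal F_0)$ and $\|\cdot\|=\|\cdot\|_{L^2(\mathbb P)}$. Let $(b_n)_{n\ge1}$ be a nondecreasing sequence of positive reals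 that is slowly varying, i.e. $b_{\lfloor tn\rfloor}/b_n\to1$ as $n\to\infty$ for every $t>0$, and assume $$\sum_{n\ge1}\frac{b_n}{n}\Big(\sum_{k\ge n}\frac{\|\mathbb E_0(S_k)\|}{k^{3/2}}\Big)^2<\infty .$$ Then there is a (strictly) stationary sequence $(D_k)_{k\in\mathbb Z}$ of square integrable random variables such that, for every $k\in\mathbb Z$, $D_k$ is $\mathcal F_{k+1}$-measurable and $\mathbb E(D_k\mid\mathcal F_k)=0$ a.s. (in case (b) one may take $D_k=D_0\circ T^k$), so that $M_n=\sum_{i=0}^{n-1}D_i$, $n\ge0$, is a martingale with respect to $(\mathcal F_n)_{n\ge0}$, and $$\frac{S_n-M_n}{\sqrt{n\,b_n^*}}\to0\quad\text{a.s.},\qquad\text{where } b_n^*=\sum_{k=1}^n\frac1{k b_k}.$$ -/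

import Mathlib

open MeasureTheory ProbabilityTheory Filter Topology
open scoped ENNReal

namespace MartApprox

/-- A real sequence `(b n)` is slowly varying if `b ⌊t n⌋ / b n → 1` for every `t > 0`. -/
def SlowlyVarying (b : ℕ → ℝ) : Prop :=
  ∀ t : ℝ, 0 < t → Tendsto (fun n : ℕ => b ⌊t * (n : ℝ)⌋₊ / b n) atTop (𝓝 1)

/-- The normalizing sequence `b* n = ∑_{k = 1}^n 1 / (k b_k)`. -/
noncomputable def bStar (b : ℕ → ℝ) (n : ℕ) : ℝ :=
  ∑ k ∈ Finset.Icc 1 n, ((k : ℝ) * b k)⁻¹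

/-- A two-sided process is (strictly) stationary if its law, as a law on sequences indexed
by `ℤ`, is invariant under all time shifts. -/
def StationaryProcess {Ω E : Type*} [MeasurableSpace Ω] [MeasurableSpace E]
    (P : Measure Ω) (Y : ℤ → Ω → E) : Prop :=
  ∀ m : ℤ, P.map (fun (ω : Ω) (k : ℤ) => Y (k + m) ω) = P.map (fun (ω : Ω) (k : ℤ) => Y k ω)

/-- The partial sum `Y 0 + ... + Y (n - 1)`. -/
def partialSum {Ω : Type*} (Y : ℤ → Ω → ℝ) (n : ℕ) (ω : Ω) : ℝ :=
  ∑ i ∈ Finset.range n, Y (i : ℤ) ω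

/-- The tail `∑_{k ≥ n} ‖E(S_k | 𝒢)‖₂ / k ^ (3/2)`, with `S_k` the partial sums of `X`,
as an element of `[0, ∞]`. -/
noncomputable def projTail {Ω : Type*} {mΩ : MeasurableSpace Ω} (P : Measure Ω)
    (𝒢 : MeasurableSpace Ω) (X : ℤ → Ω → ℝ) (n : ℕ) : ℝ≥0∞ :=
  ∑' k : Set.Ici n,
    eLpNorm (P[partialSum X (k : ℕ) | 𝒢]) 2 P / ((k : ℕ) : ℝ≥0∞) ^ (3 / 2 : ℝ)

/-- The condition `∑_{n ≥ 1} (b_n / n) (∑_{k ≥ n} ‖E(S_k | 𝒢)‖₂ / k ^ (3/2))² < ∞`.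
All sums are taken in `[0, ∞]`. -/
def ProjectiveCondition {Ω : Type*} {mΩ : MeasurableSpace Ω} (P : Measure Ω)
    (𝒢 : MeasurableSpace Ω) (X : ℤ → Ω → ℝ) (b : ℕ → ℝ) : Prop :=
  ∑' n : Set.Ici (1 : ℕ),
    ENNReal.ofReal (b (n : ℕ) / ((n : ℕ) : ℝ)) * projTail P 𝒢 X (n : ℕ) ^ 2 < ∞

/-- The restriction of a filtration indexed by `ℤ` to the nonnegative times. -/
def nonnegTimes {Ω : Type*} {mΩ : MeasurableSpace Ω} (ℱ : Filtration ℤ mΩ) :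
    Filtration ℕ mΩ where
  seq n := ℱ (n : ℤ)
  mono' _ _ h := ℱ.mono (Int.ofNat_le.mpr h)
  le' n := ℱ.le (n : ℤ)

/-- `D` is a stationary sequence of square integrable martingale differences, `D k` being
`ℱ (k + 1)`-measurable with `E(D k | ℱ k) = 0`, for all `k : ℤ`. -/
structure StationaryMartingaleDifferences {Ω : Type*} {mΩ : MeasurableSpace Ω} (P : Measure Ω)
    (ℱ : Filtration ℤ mΩ) (D : ℤ → Ω → ℝ) : Prop where
  measurable : ∀ k : ℤ, Measurable[ℱ (k + 1)] (D k)
  memLp : ∀ k : ℤ, MemLp (D k) 2 P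
  condExp_eq_zero : ∀ k : ℤ, P[D k | ℱ k] =ᵐ[P] 0
  stationary : StationaryProcess P D

/-- With `S_n` and `M_n` the partial sums of `X` and `D`: `D` is a stationary sequence of square
integrable martingale differences, `(M_n)` is a martingale, and
`(S_n - M_n) / √(n b*_n) → 0` almost surely. -/
def IsMartingaleApproximation {Ω : Type*} {mΩ : MeasurableSpace Ω} (P : Measure Ω)
    (ℱ : Filtration ℤ mΩ) (X : ℤ → Ω → ℝ) (b : ℕ → ℝ) (D : ℤ → Ω → ℝ) : Prop :=
  StationaryMartingaleDifferences P ℱ D ∧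
  Martingale (partialSum D) (nonnegTimes ℱ) P ∧
  ∀ᵐ ω ∂P, Tendsto
    (fun n : ℕ => (partialSum X n ω - partialSum D n ω) / √((n : ℝ) * bStar b n)) atTop (𝓝 0)

section Markov

variable {Ω S : Type*} {mΩ : MeasurableSpace Ω} [mS : MeasurableSpace S]

/-- The filtration `ℱ k = σ(ξ i, i ≤ k)`. -/
def pastFiltration (ξ : ℤ → Ω → S) (hξ : ∀ i, Measurable (ξ i)) : Filtration ℤ mΩ where
  seq k := ⨆ (i : ℤ) (_ : i ≤ k), mS.comap (ξ i)
  mono' _ _ h := iSup₂_le fun i hi => le_iSup₂_of_le i (hi.trans h) le_rfl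
  le' _ := iSup₂_le fun i _ => (hξ i).comap_le

/-- `ξ` is a stationary Markov chain with transition kernel `Q`:
it is a stationary process, and `P(ξ (n + 1) ∈ A | ξ i, i ≤ n) = Q (ξ n, A)` almost surely. -/
structure StationaryMarkovChain (P : Measure Ω) (Q : Kernel S S) (ξ : ℤ → Ω → S)
    (hξ : ∀ i, Measurable (ξ i)) : Prop where
  stationary : StationaryProcess P ξ
  markov : ∀ (n : ℤ) (A : Set S), MeasurableSet A →
    P[(ξ (n + 1) ⁻¹' A).indicator (fun _ => (1 : ℝ)) | pastFiltration ξ hξ n]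
      =ᵐ[P] fun ω => (Q (ξ n ω)).real A

end Markov

section Transformation

variable {Ω : Type*} {mΩ : MeasurableSpace Ω}

/-- The iterates `T ^ k`, `k : ℤ`, of a bijective bi-measurable transformation. -/
def iter (T : Ω ≃ᵐ Ω) (k : ℤ) : Ω → Ω := ⇑((T.toEquiv : Equiv.Perm Ω) ^ k)

lemma iter_add_one (T : Ω ≃ᵐ Ω) (k : ℤ) : iter T (k + 1) = T ∘ iter T k := by
  funext ω
  simp [iter, add_comm k 1, zpow_add, Equiv.Perm.mul_apply]

lemma iter_sub_one (T : Ω ≃ᵐ Ω) (k : ℤ) : iter T (k - 1) = T.symm ∘ iter T k := by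
  have h := iter_add_one T (k - 1)
  rw [sub_add_cancel] at h
  rw [h]
  funext ω
  simp

lemma measurable_iter (T : Ω ≃ᵐ Ω) (k : ℤ) : Measurable (iter T k) := by
  induction k using Int.induction_on with
  | zero => simpa [iter] using measurable_id
  | succ i ih => rw [iter_add_one]; exact T.measurable.comp ih
  | pred i ih => rw [iter_sub_one]; exact T.symm.measurable.comp ih

/-- The filtration `ℱ k = T ^ (-k) (ℱ₀)`, consisting of the sets `(T ^ k)⁻¹(A)` with
`A ∈ ℱ₀`, where `ℱ₀ ⊆ T⁻¹(ℱ₀)`. -/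
def shiftFiltration (T : Ω ≃ᵐ Ω) (ℱ₀ : MeasurableSpace Ω) (hle : ℱ₀ ≤ mΩ)
    (hT : ℱ₀ ≤ ℱ₀.comap T) : Filtration ℤ mΩ where
  seq k := ℱ₀.comap (iter T k)
  mono' := by
    refine monotone_int_of_le_succ fun k => ?_
    rw [iter_add_one, ← MeasurableSpace.comap_comp]
    exact MeasurableSpace.comap_mono hT
  le' k := (MeasurableSpace.comap_mono hle).trans (measurable_iter T k).comap_le

end Transformation

end MartApprox

/-!
In `L²(P)` the Koopman operator `V` of `T` is an isometry, and the space `K = L²(ℱ₀)` satisfies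
`K ⊆ V K`. With `E` the projection on `K`, the dyadic Cesàro means `θ` of the sequence `E Sᵢ`,
`i < 2 ^ s`, almost solve Poisson's equation `θ - E V θ = x`: the defect is `2 ^ (-s) E S_{2 ^ s}`.
Hence `x` is a martingale difference plus a coboundary plus this defect. Coboundaries are
invisible at scale `√n` and the orbit sums of the defect are small, so the martingale differences
converge as `s → ∞`, and the limiting martingale satisfies `‖S_n - M_n‖ ≤ C √n t_s` at `n = 2 ^ s`,
where `t_s` is the tail of the projective series beyond `2 ^ s`.

For almost sure convergence put `R_n = S_n - M_n`. Dyadic chaining bounds `|R_n|` by quadratic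
averages of the increments `R_{k + 2 ^ j} - R_k` over `k < 2 ^ r`, which are Birkhoff averages, so
Hopf's maximal ergodic lemma makes those at large scales `j` small uniformly in `r`. Weighting the
scale `j` by `b_{2 ^ (j - 1)}`, Cauchy–Schwarz brings in `b*_n` and gives `R_n² = o(n b*_n)`.

A stationary process is a function of the shift on its path space, which reduces it to the case
of a transformation.
-/

namespace MartApprox

section DyadicSums

lemma sum_sum_Ico_of_monotone {a : ℕ → ℕ} (ha : Monotone a) (u : ℕ → ℝ) {s r : ℕ}
    (hsr : s ≤ r) :
    ∑ j ∈ Finset.Ico s r, ∑ k ∈ Finset.Ico (a j) (a (j + 1)), u k =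
      ∑ k ∈ Finset.Ico (a s) (a r), u k := by
  induction r, hsr using Nat.le_induction with
  | base => simp
  | succ r hr ih =>
    rw [Finset.sum_Ico_succ_top hr, ih,
      Finset.sum_Ico_consecutive _ (ha hr) (ha r.le_succ)]

lemma sqrt_two_pow_mul_self (s : ℕ) : √2 ^ s * √2 ^ s = (2 : ℝ) ^ s := by
  rw [← mul_pow, Real.mul_self_sqrt zero_le_two]

lemma sum_sqrt_two_pow_le (s : ℕ) : ∑ j ∈ Finset.range s, √2 ^ j ≤ 3 * √2 ^ s := by
  have h : (4 : ℝ) / 3 ≤ √2 := Real.le_sqrt_of_sq_le (by norm_num)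
  rw [geom_sum_eq (by linarith), div_le_iff₀ (by linarith)]
  have hs : 0 < √2 ^ s := by positivity
  nlinarith

variable {e t : ℕ → ℝ}

lemma mul_le_two_mul_sum_Ico (he0 : ∀ k, 0 ≤ e k) {i m : ℕ} (him : i ≤ m)
    (he : ∀ k, e i ≤ e (i + k) + e k) :
    m * e i ≤ 2 * ∑ k ∈ Finset.Ico m (4 * m), e k := by
  have hshift : ∑ k ∈ Finset.Ico m (2 * m), e (i + k) ≤ ∑ k ∈ Finset.Ico m (4 * m), e k := by
    rw [Finset.sum_Ico_add]
    exact Finset.sum_le_sum_of_subset_of_nonneg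
      (Finset.Ico_subset_Ico (by omega) (by omega)) fun k _ _ => he0 k
  have hblock : ∑ k ∈ Finset.Ico m (2 * m), e k ≤ ∑ k ∈ Finset.Ico m (4 * m), e k :=
    Finset.sum_le_sum_of_subset_of_nonneg
      (Finset.Ico_subset_Ico le_rfl (by omega)) fun k _ _ => he0 k
  calc m * e i = ∑ _k ∈ Finset.Ico m (2 * m), e i := by simp [two_mul]
    _ ≤ ∑ k ∈ Finset.Ico m (2 * m), (e (i + k) + e k) := Finset.sum_le_sum fun k _ => he k
    _ ≤ 2 * ∑ k ∈ Finset.Ico m (4 * m), e k := by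
        rw [Finset.sum_add_distrib]
        linarith

lemma four_mul_two_pow_rpow (s : ℕ) :
    (4 * 2 ^ s : ℝ) ^ (3 / 2 : ℝ) = 8 * (√2 ^ s * 2 ^ s) := by
  have hsqrt : √(4 * 2 ^ s : ℝ) = 2 * √2 ^ s := by
    rw [Real.sqrt_eq_iff_mul_self_eq (by positivity) (by positivity), ← sqrt_two_pow_mul_self]
    ring
  rw [show (3 / 2 : ℝ) = 1 / 2 + 1 by norm_num, Real.rpow_add_one (by positivity),
    ← Real.sqrt_eq_rpow, hsqrt]
  ring

lemma le_sqrt_two_pow_mul_sum (he0 : ∀ k, 0 ≤ e k) {i s : ℕ} (his : i ≤ 2 ^ s)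
    (he : ∀ k, e i ≤ e (i + k) + e k) :
    e i ≤ 16 * √2 ^ s *
      ∑ k ∈ Finset.Ico (2 ^ s) (2 ^ (s + 2)), e k / (k : ℝ) ^ (3 / 2 : ℝ) := by
  have hdiv : ∀ k ∈ Finset.Ico (2 ^ s) (4 * 2 ^ s),
      e k ≤ 8 * (√2 ^ s * 2 ^ s) * (e k / (k : ℝ) ^ (3 / 2 : ℝ)) := by
    intro k hk
    obtain ⟨hsk, hk4⟩ := Finset.mem_Ico.1 hk
    have hk0 : (0 : ℝ) < k := by exact_mod_cast (Nat.two_pow_pos s).trans_le hsk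
    have hk4' : (k : ℝ) ≤ 4 * 2 ^ s := by exact_mod_cast hk4.le
    rw [mul_div_assoc', le_div_iff₀ (by positivity), mul_comm, ← four_mul_two_pow_rpow]
    have := he0 k
    gcongr
  have hsum := (mul_le_two_mul_sum_Ico he0 his he).trans
    (mul_le_mul_of_nonneg_left (Finset.sum_le_sum hdiv) zero_le_two)
  rw [← Finset.mul_sum] at hsum
  rw [pow_add, mul_comm (2 ^ s) (2 ^ 2)]
  refine le_of_mul_le_mul_left (hsum.trans_eq ?_) (Nat.cast_pos.2 (Nat.two_pow_pos s))
  push_cast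
  ring

/-- `t s` dominates the part of `∑ e k / k ^ (3/2)` beyond `2 ^ s`. -/
def IsDyadicTailBound (e t : ℕ → ℝ) : Prop :=
  ∀ s N : ℕ, ∑ k ∈ Finset.Ico (2 ^ s) N, e k / (k : ℝ) ^ (3 / 2 : ℝ) ≤ t s

namespace IsDyadicTailBound

lemma nonneg (ht : IsDyadicTailBound e t) (s : ℕ) : 0 ≤ t s := by
  simpa using ht s 0

lemma le_sqrt_two_pow_mul (ht : IsDyadicTailBound e t) (he0 : ∀ k, 0 ≤ e k) {i s : ℕ}
    (his : i ≤ 2 ^ s) (he : ∀ k, e i ≤ e (i + k) + e k) : e i ≤ 16 * √2 ^ s * t s :=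
  (le_sqrt_two_pow_mul_sum he0 his he).trans
    (mul_le_mul_of_nonneg_left (ht s _) (by positivity))

lemma sum_dyadic_le (ht : IsDyadicTailBound e t) (he0 : ∀ k, 0 ≤ e k)
    (he : ∀ i k, e i ≤ e (i + k) + e k) (s r : ℕ) :
    ∑ j ∈ Finset.Ico s r, e (2 ^ j) / √2 ^ j ≤ 32 * t s := by
  rcases le_or_gt r s with hrs | hsr
  · simpa [Finset.Ico_eq_empty (not_lt.2 hrs)] using ht.nonneg s
  set u : ℕ → ℝ := fun k => e k / (k : ℝ) ^ (3 / 2 : ℝ)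
  have hu0 : ∀ k, 0 ≤ u k := fun k => div_nonneg (he0 k) (by positivity)
  have hpow : Monotone fun j : ℕ => 2 ^ j := pow_right_mono₀ one_le_two
  have hpow_succ : Monotone fun j : ℕ => 2 ^ (j + 1) := fun _ _ h => hpow (Nat.succ_le_succ h)
  have hterm : ∀ j ∈ Finset.Ico s r, e (2 ^ j) / √2 ^ j ≤
      16 * (∑ k ∈ Finset.Ico (2 ^ j) (2 ^ (j + 1)), u k +
        ∑ k ∈ Finset.Ico (2 ^ (j + 1)) (2 ^ (j + 1 + 1)), u k) := by
    intro j _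
    rw [Finset.sum_Ico_consecutive _ (hpow j.le_succ) (hpow (j + 1).le_succ),
      div_le_iff₀ (by positivity)]
    exact (le_sqrt_two_pow_mul_sum he0 le_rfl (he _)).trans_eq (by ring)
  have hlow : ∑ k ∈ Finset.Ico (2 ^ s) (2 ^ r), u k ≤ t s := ht s _
  have hhigh : ∑ k ∈ Finset.Ico (2 ^ (s + 1)) (2 ^ (r + 1)), u k ≤ t s :=
    (Finset.sum_le_sum_of_subset_of_nonneg (Finset.Ico_subset_Ico
      (hpow s.le_succ) le_rfl) fun k _ _ => hu0 k).trans (ht s _)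
  calc ∑ j ∈ Finset.Ico s r, e (2 ^ j) / √2 ^ j
      ≤ ∑ j ∈ Finset.Ico s r, 16 * (∑ k ∈ Finset.Ico (2 ^ j) (2 ^ (j + 1)), u k +
        ∑ k ∈ Finset.Ico (2 ^ (j + 1)) (2 ^ (j + 1 + 1)), u k) := Finset.sum_le_sum hterm
    _ = 16 * (∑ k ∈ Finset.Ico (2 ^ s) (2 ^ r), u k +
        ∑ k ∈ Finset.Ico (2 ^ (s + 1)) (2 ^ (r + 1)), u k) := by
      rw [← Finset.mul_sum, Finset.sum_add_distrib]
      exact congrArg (16 * ·) (congrArg₂ (· + ·) (sum_sum_Ico_of_monotone hpow u hsr.le)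
        (sum_sum_Ico_of_monotone hpow_succ u hsr.le))
    _ ≤ 32 * t s := by linarith

end IsDyadicTailBound

end DyadicSums

section OrbitSum

variable {H : Type*} [NormedAddCommGroup H] [InnerProductSpace ℝ H]

/-- The operator `∑_{i < n} V ^ i`, the abstract partial sum of the orbit of a vector under an
isometry `V`. -/
noncomputable def orbitSum (V : H →ₗᵢ[ℝ] H) (n : ℕ) : H →ₗ[ℝ] H :=
  ∑ i ∈ Finset.range n, (V ^ i).toLinearMap

lemma orbitSum_apply (V : H →ₗᵢ[ℝ] H) (n : ℕ) (x : H) :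
    orbitSum V n x = ∑ i ∈ Finset.range n, (V ^ i) x := by
  simp [orbitSum, LinearMap.sum_apply]

lemma orbitSum_zero (V : H →ₗᵢ[ℝ] H) (x : H) : orbitSum V 0 x = 0 := by
  simp [orbitSum_apply]

lemma orbitSum_one (V : H →ₗᵢ[ℝ] H) (x : H) : orbitSum V 1 x = x := by
  simp [orbitSum_apply]

lemma orbitSum_succ (V : H →ₗᵢ[ℝ] H) (n : ℕ) (x : H) :
    orbitSum V (n + 1) x = orbitSum V n x + (V ^ n) x := by
  simp [orbitSum_apply, Finset.sum_range_succ]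

lemma orbitSum_add (V : H →ₗᵢ[ℝ] H) (m n : ℕ) (x : H) :
    orbitSum V (m + n) x = orbitSum V m x + (V ^ m) (orbitSum V n x) := by
  simp [orbitSum_apply, Finset.sum_range_add, pow_add, LinearIsometry.coe_mul, map_sum]

lemma orbitSum_succ' (V : H →ₗᵢ[ℝ] H) (n : ℕ) (x : H) :
    orbitSum V (n + 1) x = x + V (orbitSum V n x) := by
  rw [add_comm, orbitSum_add, orbitSum_one, pow_one]

lemma pow_apply_orbitSum (V : H →ₗᵢ[ℝ] H) (m n : ℕ) (x : H) :
    (V ^ m) (orbitSum V n x) = orbitSum V n ((V ^ m) x) := by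
  rw [orbitSum_apply, orbitSum_apply, map_sum]
  exact Finset.sum_congr rfl fun i _ =>
    DFunLike.congr_fun ((Commute.refl V).pow_pow m i).eq x

lemma orbitSum_comm (V : H →ₗᵢ[ℝ] H) (m n : ℕ) (x : H) :
    orbitSum V m (orbitSum V n x) = orbitSum V n (orbitSum V m x) := by
  rw [orbitSum_apply V m, orbitSum_apply V m, map_sum]
  exact Finset.sum_congr rfl fun i _ => pow_apply_orbitSum V i n x

lemma orbitSum_apply_self (V : H →ₗᵢ[ℝ] H) (n : ℕ) (x : H) :
    orbitSum V n (V x) = V (orbitSum V n x) := by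
  simpa only [pow_one] using (pow_apply_orbitSum V 1 n x).symm

lemma orbitSum_sub_apply_self (V : H →ₗᵢ[ℝ] H) (n : ℕ) (x : H) :
    orbitSum V n (x - V x) = x - (V ^ n) x := by
  rw [map_sub, orbitSum_apply_self, sub_eq_sub_iff_add_eq_add, ← orbitSum_succ, orbitSum_succ']

lemma norm_orbitSum_sub_apply_self_le (V : H →ₗᵢ[ℝ] H) (n : ℕ) (x : H) :
    ‖orbitSum V n (x - V x)‖ ≤ 2 * ‖x‖ := by
  rw [orbitSum_sub_apply_self, two_mul]
  exact (norm_sub_le _ _).trans_eq (by rw [(V ^ n).norm_map])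

lemma inner_pow_apply_eq_inner_proj (V : H →ₗᵢ[ℝ] H) {K : Submodule ℝ H}
    [K.HasOrthogonalProjection] {z : H} (hz : z ∈ K) (n : ℕ) (y : H) :
    inner ℝ ((V ^ n) z) ((V ^ n) y) = inner ℝ z (K.starProjection y) := by
  rw [(V ^ n).inner_map_map, ← K.inner_starProjection_left_eq_right,
    K.starProjection_eq_self_iff.2 hz]

end OrbitSum

section IsometricPast

/- `K` plays the role of `L²(ℱ₀)`, and `K ≤ V K` encodes that the filtration increases. -/
variable {H : Type*} [NormedAddCommGroup H] [InnerProductSpace ℝ H] {V : H →ₗᵢ[ℝ] H}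
  {K : Submodule ℝ H} (hK : K ≤ K.map V.toLinearMap)

include hK

lemma exists_pow_apply_eq_orbitSum {x : H} (hx : x ∈ K) (n : ℕ) :
    ∃ z ∈ K, (V ^ n) z = orbitSum V n x := by
  induction n with
  | zero => exact ⟨0, K.zero_mem, by simp [orbitSum_zero]⟩
  | succ n ih =>
    obtain ⟨z, hz, hzx⟩ := ih
    obtain ⟨y, hy, hyz⟩ := hK (K.add_mem hz hx)
    rw [LinearIsometry.coe_toLinearMap] at hyz
    exact ⟨y, hy, by
      rw [pow_succ, LinearIsometry.coe_mul, Function.comp_apply, hyz, map_add, hzx, orbitSum_succ]⟩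

lemma exists_pow_apply_eq_orbitSum_apply {x : H} (hx : x ∈ K) (n : ℕ) :
    ∃ z ∈ K, (V ^ n) z = orbitSum V n (V x) := by
  cases n with
  | zero => exact ⟨0, K.zero_mem, by simp [orbitSum_zero]⟩
  | succ m =>
    obtain ⟨z, hz, hzx⟩ := exists_pow_apply_eq_orbitSum hK hx m
    exact ⟨z + x, K.add_mem hz hx, by
      rw [pow_succ', LinearIsometry.coe_mul, Function.comp_apply, map_add, hzx, ← orbitSum_succ,
        orbitSum_apply_self]⟩

variable [K.HasOrthogonalProjection]

lemma proj_apply_proj (y : H) :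
    K.starProjection (V (K.starProjection y)) = K.starProjection (V y) := by
  rw [eq_comm, ← sub_eq_zero, ← map_sub, ← map_sub, Submodule.starProjection_apply_eq_zero_iff]
  intro k hk
  obtain ⟨k', hk', rfl⟩ := hK hk
  rw [LinearIsometry.coe_toLinearMap, V.inner_map_map, real_inner_comm]
  exact K.starProjection_inner_eq_zero y k' hk'

lemma proj_pow_apply_proj (n : ℕ) (y : H) :
    K.starProjection ((V ^ n) (K.starProjection y)) = K.starProjection ((V ^ n) y) := by
  induction n with
  | zero => exact K.starProjection_eq_self_iff.2 (K.starProjection_apply_mem y)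
  | succ n ih =>
    rw [pow_succ', LinearIsometry.coe_mul, Function.comp_apply, Function.comp_apply,
      ← proj_apply_proj hK, ih, proj_apply_proj hK]

lemma norm_proj_pow_apply_le (n : ℕ) (y : H) :
    ‖K.starProjection ((V ^ n) y)‖ ≤ ‖K.starProjection y‖ := by
  rw [← proj_pow_apply_proj hK]
  exact (K.norm_starProjection_apply_le _).trans ((V ^ n).norm_map _).le

lemma proj_orbitSum_proj (n : ℕ) (y : H) :
    K.starProjection (orbitSum V n (K.starProjection y)) = K.starProjection (orbitSum V n y) := by
  simp only [orbitSum_apply, map_sum, proj_pow_apply_proj hK]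

lemma norm_proj_orbitSum_le (n : ℕ) (y : H) :
    ‖K.starProjection (orbitSum V n y)‖ ≤ n * ‖K.starProjection y‖ := by
  rw [orbitSum_apply, map_sum]
  exact (norm_sum_le_of_le _ fun i _ => norm_proj_pow_apply_le hK i y).trans_eq (by simp)

lemma norm_proj_orbitSum_le_add (i k : ℕ) (x : H) :
    ‖K.starProjection (orbitSum V i x)‖ ≤
      ‖K.starProjection (orbitSum V (i + k) x)‖ + ‖K.starProjection (orbitSum V k x)‖ := by
  rw [← add_sub_cancel_right (orbitSum V i x) ((V ^ i) (orbitSum V k x)), ← orbitSum_add, map_sub]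
  exact (norm_sub_le _ _).trans (add_le_add_right (norm_proj_pow_apply_le hK i _) _)

lemma inner_orbitSum_pow_apply_le {x : H} (hx : x ∈ K) (n : ℕ) (y : H) :
    inner ℝ (orbitSum V n x) ((V ^ n) y) ≤ ‖orbitSum V n x‖ * ‖K.starProjection y‖ := by
  obtain ⟨z, hz, hzx⟩ := exists_pow_apply_eq_orbitSum hK hx n
  rw [← hzx, inner_pow_apply_eq_inner_proj V hz, (V ^ n).norm_map]
  exact real_inner_le_norm _ _

lemma norm_orbitSum_two_mul_le {x : H} (hx : x ∈ K) (n : ℕ) :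
    ‖orbitSum V (2 * n) x‖ ≤
      √2 * (‖orbitSum V n x‖ + ‖K.starProjection (orbitSum V n x)‖ / 2) := by
  have hinner := inner_orbitSum_pow_apply_le hK hx n (orbitSum V n x)
  have hsq := norm_add_sq_real (orbitSum V n x) ((V ^ n) (orbitSum V n x))
  rw [(V ^ n).norm_map, ← orbitSum_add, ← two_mul] at hsq
  refine le_of_sq_le_sq ?_ (by positivity)
  rw [mul_pow, Real.sq_sqrt zero_le_two, hsq]
  nlinarith [sq_nonneg ‖K.starProjection (orbitSum V n x)‖]

lemma norm_orbitSum_two_pow_le {x : H} (hx : x ∈ K) (r : ℕ) :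
    ‖orbitSum V (2 ^ r) x‖ ≤ √2 ^ r * (‖x‖ +
      (∑ j ∈ Finset.range r, ‖K.starProjection (orbitSum V (2 ^ j) x)‖ / √2 ^ j) / 2) := by
  induction r with
  | zero => simp [orbitSum_one]
  | succ r ih =>
    rw [pow_succ', Finset.sum_range_succ]
    refine (norm_orbitSum_two_mul_le hK hx _).trans ?_
    calc √2 * (‖orbitSum V (2 ^ r) x‖ + ‖K.starProjection (orbitSum V (2 ^ r) x)‖ / 2)
        ≤ √2 * (√2 ^ r * (‖x‖ +
            (∑ j ∈ Finset.range r, ‖K.starProjection (orbitSum V (2 ^ j) x)‖ / √2 ^ j) / 2) +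
          ‖K.starProjection (orbitSum V (2 ^ r) x)‖ / 2) := by gcongr
      _ = _ := by field_simp; ring

lemma norm_orbitSum_apply_of_proj_eq_zero {z : H} (hz : z ∈ K)
    (hVz : K.starProjection (V z) = 0) (n : ℕ) :
    ‖orbitSum V n (V z)‖ = √n * ‖z‖ := by
  suffices ‖orbitSum V n (V z)‖ ^ 2 = n * ‖z‖ ^ 2 by
    rw [← sq_eq_sq₀ (norm_nonneg _) (by positivity), this, mul_pow, Real.sq_sqrt n.cast_nonneg]
  induction n with
  | zero => simp [orbitSum_zero]
  | succ n ih =>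
    have horth : inner ℝ (orbitSum V n (V z)) ((V ^ n) (V z)) = 0 := by
      obtain ⟨y, hy, hyz⟩ := exists_pow_apply_eq_orbitSum_apply hK hz n
      rw [← hyz, inner_pow_apply_eq_inner_proj V hy, hVz, inner_zero_right]
    rw [orbitSum_succ, norm_add_sq_real, horth, ih, (V ^ n).norm_map, V.norm_map]
    push_cast
    ring

end IsometricPast

section Poisson

variable {H : Type*} [NormedAddCommGroup H] [InnerProductSpace ℝ H] {V : H →ₗᵢ[ℝ] H}
  {K : Submodule ℝ H} [K.HasOrthogonalProjection] {x : H} {t : ℕ → ℝ}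

/-- The Cesàro mean `(1 / n) ∑_{i < n} E S_i`, with `E` the projection on `K`: an approximate
solution `θ` of Poisson's equation `θ - E V θ = x`. -/
noncomputable def poisson (V : H →ₗᵢ[ℝ] H) (K : Submodule ℝ H) [K.HasOrthogonalProjection]
    (x : H) (n : ℕ) : H :=
  (n : ℝ)⁻¹ • ∑ i ∈ Finset.range n, K.starProjection (orbitSum V i x)

/-- The error `(1 / n) E S_n` made by `poisson V K x n` in Poisson's equation. -/
noncomputable def defect (V : H →ₗᵢ[ℝ] H) (K : Submodule ℝ H) [K.HasOrthogonalProjection]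
    (x : H) (n : ℕ) : H :=
  (n : ℝ)⁻¹ • K.starProjection (orbitSum V n x)

lemma poisson_mem (x : H) (n : ℕ) : poisson V K x n ∈ K :=
  K.smul_mem _ (K.sum_mem fun _ _ => K.starProjection_apply_mem _)

lemma defect_mem (x : H) (n : ℕ) : defect V K x n ∈ K :=
  K.smul_mem _ (K.starProjection_apply_mem _)

lemma poisson_sub_proj_apply_poisson (hK : K ≤ K.map V.toLinearMap) (hx : x ∈ K) {n : ℕ}
    (hn : n ≠ 0) :
    poisson V K x n - K.starProjection (V (poisson V K x n)) = x - defect V K x n := by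
  have hstep : ∀ i, K.starProjection (V (K.starProjection (orbitSum V i x))) =
      K.starProjection (orbitSum V (i + 1) x) - x := by
    intro i
    rw [proj_apply_proj hK, orbitSum_succ', map_add, K.starProjection_eq_self_iff.2 hx,
      add_sub_cancel_left]
  have htelescope := Finset.sum_range_sub (fun i => K.starProjection (orbitSum V i x)) n
  simp only [orbitSum_zero, map_zero, sub_zero, Finset.sum_sub_distrib] at htelescope
  rw [poisson, defect, map_smul, map_smul, map_sum, map_sum, ← smul_sub]
  simp only [hstep, Finset.sum_sub_distrib, Finset.sum_const, Finset.card_range]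
  rw [← htelescope, ← Nat.cast_smul_eq_nsmul ℝ, smul_sub, smul_sub, smul_sub,
    inv_smul_smul₀ (Nat.cast_ne_zero.2 hn)]
  abel

lemma norm_poisson_le_of_forall_norm_proj_le {n : ℕ} {c : ℝ} (hc : 0 ≤ c)
    (h : ∀ i < n, ‖K.starProjection (orbitSum V i x)‖ ≤ c) : ‖poisson V K x n‖ ≤ c := by
  rcases n.eq_zero_or_pos with rfl | hn
  · simpa [poisson] using hc
  rw [poisson, norm_smul, norm_inv, Real.norm_natCast, inv_mul_le_iff₀ (Nat.cast_pos.2 hn)]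
  exact (norm_sum_le_of_le _ fun i hi => h i (Finset.mem_range.1 hi)).trans_eq (by simp)

lemma proj_orbitSum_defect (hK : K ≤ K.map V.toLinearMap) (x : H) (m n : ℕ) :
    K.starProjection (orbitSum V m (defect V K x n)) =
      (n : ℝ)⁻¹ • K.starProjection (orbitSum V m (orbitSum V n x)) := by
  rw [defect, map_smul, map_smul, proj_orbitSum_proj hK]

lemma norm_proj_orbitSum_defect_le (hK : K ≤ K.map V.toLinearMap) (x : H) (m n : ℕ) :
    ‖K.starProjection (orbitSum V m (defect V K x n))‖ ≤
      m * (‖K.starProjection (orbitSum V n x)‖ / n) := by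
  rw [proj_orbitSum_defect hK, norm_smul, norm_inv, Real.norm_natCast, inv_mul_eq_div,
    mul_div_assoc']
  gcongr
  exact norm_proj_orbitSum_le hK _ _

lemma norm_proj_orbitSum_defect_le_norm_proj_orbitSum (hK : K ≤ K.map V.toLinearMap) (x : H)
    (m n : ℕ) :
    ‖K.starProjection (orbitSum V m (defect V K x n))‖ ≤
      ‖K.starProjection (orbitSum V m x)‖ := by
  rw [proj_orbitSum_defect hK, norm_smul, norm_inv, Real.norm_natCast, orbitSum_comm,
    inv_mul_eq_div]
  refine div_le_of_le_mul₀ n.cast_nonneg (norm_nonneg _) ?_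
  rw [mul_comm]
  exact norm_proj_orbitSum_le hK _ _

lemma sum_norm_proj_orbitSum_defect_le (hK : K ≤ K.map V.toLinearMap)
    (ht : IsDyadicTailBound (fun k => ‖K.starProjection (orbitSum V k x)‖) t) (s r : ℕ) :
    ∑ j ∈ Finset.range r,
      ‖K.starProjection (orbitSum V (2 ^ j) (defect V K x (2 ^ s)))‖ / √2 ^ j ≤ 80 * t s := by
  set v : ℕ → ℝ := fun j =>
    ‖K.starProjection (orbitSum V (2 ^ j) (defect V K x (2 ^ s)))‖ / √2 ^ j with hv
  have ht0 : 0 ≤ t s := ht.nonneg s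
  have hlow : ∀ j, v j ≤ √2 ^ j * (16 * t s / √2 ^ s) := by
    intro j
    have hs : ‖K.starProjection (orbitSum V (2 ^ s) x)‖ ≤ 16 * √2 ^ s * t s :=
      ht.le_sqrt_two_pow_mul (fun _ => norm_nonneg _) le_rfl (norm_proj_orbitSum_le_add hK _ · x)
    rw [hv, div_le_iff₀ (by positivity)]
    refine (norm_proj_orbitSum_defect_le hK x _ _).trans ?_
    push_cast
    rw [← sqrt_two_pow_mul_self j, ← sqrt_two_pow_mul_self s]
    calc √2 ^ j * √2 ^ j * (‖K.starProjection (orbitSum V (2 ^ s) x)‖ / (√2 ^ s * √2 ^ s))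
        ≤ √2 ^ j * √2 ^ j * (16 * √2 ^ s * t s / (√2 ^ s * √2 ^ s)) := by gcongr
      _ = √2 ^ j * (16 * t s / √2 ^ s) * √2 ^ j := by field_simp
  have hsmall : ∑ j ∈ Finset.range s, v j ≤ 48 * t s := by
    refine (Finset.sum_le_sum fun j _ => hlow j).trans ?_
    rw [← Finset.sum_mul]
    refine (mul_le_mul_of_nonneg_right (sum_sqrt_two_pow_le s) (by positivity)).trans_eq ?_
    field_simp
    ring
  have hlarge : ∑ j ∈ Finset.Ico s r, v j ≤ 32 * t s := by
    refine le_trans (Finset.sum_le_sum fun j _ => ?_)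
      (ht.sum_dyadic_le (fun _ => norm_nonneg _) (norm_proj_orbitSum_le_add hK · · x) s r)
    exact div_le_div_of_nonneg_right
      (norm_proj_orbitSum_defect_le_norm_proj_orbitSum hK x _ _) (by positivity)
  have hcover : ∑ j ∈ Finset.range r, v j ≤
      ∑ j ∈ Finset.range s, v j + ∑ j ∈ Finset.Ico s r, v j := by
    rw [← Finset.sum_union (Finset.disjoint_left.2 fun j hj hj' =>
      (Finset.mem_Ico.1 hj').1.not_gt (Finset.mem_range.1 hj))]
    exact Finset.sum_le_sum_of_subset_of_nonneg (fun j hj => by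
      simp only [Finset.mem_union, Finset.mem_range, Finset.mem_Ico] at hj ⊢
      omega) fun j _ _ => by positivity
  linarith

lemma norm_orbitSum_defect_le (hK : K ≤ K.map V.toLinearMap)
    (ht : IsDyadicTailBound (fun k => ‖K.starProjection (orbitSum V k x)‖) t) (s r : ℕ) :
    ‖orbitSum V (2 ^ r) (defect V K x (2 ^ s))‖ ≤ √2 ^ r * (56 * t s) := by
  have hdefect : ‖defect V K x (2 ^ s)‖ ≤ 16 * t s := by
    have hone : (1 : ℝ) ≤ √2 ^ s := one_le_pow₀ (Real.one_le_sqrt.2 one_le_two)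
    rw [defect, norm_smul, norm_inv, Real.norm_natCast, Nat.cast_pow, Nat.cast_ofNat,
      inv_mul_le_iff₀ (by positivity), ← sqrt_two_pow_mul_self]
    refine (ht.le_sqrt_two_pow_mul (fun _ => norm_nonneg _) le_rfl
      (norm_proj_orbitSum_le_add hK _ · x)).trans ?_
    have hpos : 0 ≤ √2 ^ s * t s := mul_nonneg (by positivity) (ht.nonneg s)
    nlinarith
  refine (norm_orbitSum_two_pow_le hK (defect_mem x _) r).trans
    (mul_le_mul_of_nonneg_left ?_ (by positivity))
  linarith [sum_norm_proj_orbitSum_defect_le hK ht s r]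

lemma exists_martingaleDifference (hK : K ≤ K.map V.toLinearMap) (hx : x ∈ K) {n : ℕ}
    (hn : n ≠ 0) :
    ∃ z ∈ K, K.starProjection (V z) = 0 ∧
      x - V z = defect V K x n + (poisson V K x n - V (poisson V K x n)) := by
  set θ := poisson V K x n
  set d := defect V K x n
  obtain ⟨y, hy, hyV⟩ := hK (K.starProjection_apply_mem (V θ))
  rw [LinearIsometry.coe_toLinearMap] at hyV
  refine ⟨θ - y, K.sub_mem (poisson_mem x n) hy, ?_, ?_⟩
  · rw [map_sub, map_sub, hyV, K.starProjection_eq_self_iff.2 (K.starProjection_apply_mem _),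
      sub_self]
  · have hpoisson : θ - K.starProjection (V θ) = x - d :=
      poisson_sub_proj_apply_poisson hK hx hn
    rw [map_sub, hyV, eq_add_of_sub_eq' hpoisson.symm]
    abel

/-- Coboundaries have bounded orbit sums, so they are invisible at the scale `√n`. -/
lemma norm_le_of_apply_eq_add_coboundary (hK : K ≤ K.map V.toLinearMap) {z d θ : H} {c : ℝ}
    (hz : z ∈ K) (hVz : K.starProjection (V z) = 0) (h : V z = d + (θ - V θ))
    (hd : ∀ r : ℕ, ‖orbitSum V (2 ^ r) d‖ ≤ √2 ^ r * c) : ‖z‖ ≤ c := by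
  have hbound : ∀ r : ℕ, ‖z‖ ≤ c + 2 * ‖θ‖ * (√2 ^ r)⁻¹ := by
    intro r
    have hr : 0 < √2 ^ r := by positivity
    have hsum := norm_orbitSum_apply_of_proj_eq_zero hK hz hVz (2 ^ r)
    rw [Nat.cast_pow, Nat.cast_ofNat, ← sqrt_two_pow_mul_self, Real.sqrt_mul_self hr.le, h,
      map_add] at hsum
    have hle : √2 ^ r * ‖z‖ ≤ √2 ^ r * c + 2 * ‖θ‖ := hsum.symm.trans_le
      ((norm_add_le _ _).trans (add_le_add (hd r) (norm_orbitSum_sub_apply_self_le V _ θ)))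
    refine le_of_mul_le_mul_left (hle.trans_eq ?_) hr
    field_simp
  have hlim : Tendsto (fun r : ℕ => c + 2 * ‖θ‖ * (√2 ^ r)⁻¹) atTop (𝓝 (c + 2 * ‖θ‖ * 0)) :=
    tendsto_const_nhds.add (tendsto_const_nhds.mul (tendsto_pow_atTop_atTop_of_one_lt
      (Real.lt_sqrt_of_sq_lt (by norm_num))).inv_tendsto_atTop)
  rw [mul_zero, add_zero] at hlim
  exact ge_of_tendsto' hlim hbound

end Poisson

lemma exists_tendsto_of_dist_le_add {E : Type*} [PseudoMetricSpace E] [CompleteSpace E]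
    {u : ℕ → E} {δ : ℕ → ℝ} (hu : ∀ m n, dist (u m) (u n) ≤ δ m + δ n)
    (hδ : Tendsto δ atTop (𝓝 0)) :
    ∃ a, Tendsto u atTop (𝓝 a) ∧ ∀ n, dist (u n) a ≤ δ n := by
  have hcauchy : CauchySeq u := by
    refine cauchySeq_iff_tendsto_dist_atTop_0.2
      (squeeze_zero (fun _ => dist_nonneg) (fun p => hu p.1 p.2) ?_)
    rw [← prod_atTop_atTop_eq]
    simpa using (hδ.comp tendsto_fst).add (hδ.comp tendsto_snd)
  obtain ⟨a, ha⟩ := cauchySeq_tendsto_of_complete hcauchy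
  refine ⟨a, ha, fun n => ?_⟩
  have hlim : Tendsto (fun m => δ n + δ m) atTop (𝓝 (δ n + 0)) := tendsto_const_nhds.add hδ
  rw [add_zero] at hlim
  exact le_of_tendsto_of_tendsto' (tendsto_const_nhds.dist ha) hlim (hu n)

theorem exists_norm_orbitSum_sub_apply_le {H : Type*} [NormedAddCommGroup H]
    [InnerProductSpace ℝ H] {V : H →ₗᵢ[ℝ] H} {K : Submodule ℝ H} [CompleteSpace K]
    (hK : K ≤ K.map V.toLinearMap) {x : H} (hx : x ∈ K) {t : ℕ → ℝ}
    (ht : IsDyadicTailBound (fun k => ‖K.starProjection (orbitSum V k x)‖) t)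
    (ht0 : Tendsto t atTop (𝓝 0)) :
    ∃ z ∈ K, K.starProjection (V z) = 0 ∧
      ∀ s, ‖orbitSum V (2 ^ s) (x - V z)‖ ≤ 144 * √2 ^ s * t s := by
  have hdefect := norm_orbitSum_defect_le hK ht
  choose y hyK hy0 hy using fun s : ℕ => exists_martingaleDifference hK hx (Nat.two_pow_pos s).ne'
  set d := fun s : ℕ => defect V K x (2 ^ s)
  set θ := fun s : ℕ => poisson V K x (2 ^ s)
  have hdist : ∀ s s', dist (⟨y s, hyK s⟩ : K) ⟨y s', hyK s'⟩ ≤ 56 * t s + 56 * t s' := by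
    intro s s'
    rw [Subtype.dist_eq, dist_eq_norm]
    refine norm_le_of_apply_eq_add_coboundary hK (θ := θ s' - θ s) (d := d s' - d s)
      (K.sub_mem (hyK s) (hyK s')) (by rw [map_sub, map_sub, hy0, hy0, sub_self]) ?_ fun r => ?_
    · rw [map_sub, map_sub, ← sub_sub_sub_cancel_left (V (y s')) (V (y s)) x, hy, hy]
      abel
    · rw [map_sub]
      linarith [norm_sub_le (orbitSum V (2 ^ r) (d s')) (orbitSum V (2 ^ r) (d s)),
        hdefect s r, hdefect s' r]
  obtain ⟨z, hyz, hzdist⟩ := exists_tendsto_of_dist_le_add hdist (by simpa using ht0.const_mul 56)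
  have hz0 : K.starProjection (V z) = 0 := by
    have hlim := ((K.starProjection.continuous.comp V.continuous).comp
      continuous_subtype_val).continuousAt.tendsto.comp hyz
    exact tendsto_nhds_unique hlim (by simp [Function.comp_def, hy0])
  refine ⟨z, z.2, hz0, fun s => ?_⟩
  have hsplit : x - V z = d s + (θ s - V (θ s)) + V (y s - z) := by
    rw [map_sub, ← hy s]
    abel
  have hpoisson : ‖θ s‖ ≤ 16 * √2 ^ s * t s :=
    norm_poisson_le_of_forall_norm_proj_le (mul_nonneg (by positivity) (ht.nonneg s)) fun i hi =>
      ht.le_sqrt_two_pow_mul (fun _ => norm_nonneg _) hi.le (norm_proj_orbitSum_le_add hK i · x)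
  have hdiff : ‖orbitSum V (2 ^ s) (V (y s - z))‖ ≤ √2 ^ s * (56 * t s) := by
    rw [norm_orbitSum_apply_of_proj_eq_zero hK (K.sub_mem (hyK s) z.2)
      (by rw [map_sub, map_sub, hy0, hz0, sub_self]), Nat.cast_pow, Nat.cast_ofNat,
      ← sqrt_two_pow_mul_self, Real.sqrt_mul_self (by positivity)]
    gcongr
    exact (dist_eq_norm (y s) z).symm.trans_le (hzdist s)
  rw [hsplit, map_add, map_add]
  refine norm_add₃_le.trans ?_
  linarith [hdefect s s, norm_orbitSum_sub_apply_self_le V (2 ^ s) (θ s)]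

section Dyadic

/-- The mean of `R` over the dyadic block `[2 ^ j q, 2 ^ j (q + 1))`. -/
noncomputable def dyadicMean (R : ℕ → ℝ) (j q : ℕ) : ℝ :=
  (∑ k ∈ Finset.range (2 ^ j), R (2 ^ j * q + k)) / 2 ^ j

variable (R : ℕ → ℝ)

lemma dyadicMean_zero (q : ℕ) : dyadicMean R 0 q = R q := by simp [dyadicMean]

lemma dyadicMean_succ (j q : ℕ) :
    dyadicMean R (j + 1) q = (dyadicMean R j (2 * q) + dyadicMean R j (2 * q + 1)) / 2 := by
  have hleft : ∀ k, 2 ^ (j + 1) * q + k = 2 ^ j * (2 * q) + k := fun k => by ring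
  have hright : ∀ k, 2 ^ j * (2 * q) + (2 ^ j + k) = 2 ^ j * (2 * q + 1) + k := fun k => by ring
  rw [dyadicMean, show Finset.range (2 ^ (j + 1)) = Finset.range (2 ^ j + 2 ^ j) by ring_nf,
    Finset.sum_range_add, dyadicMean, dyadicMean, ← add_div, div_div, pow_succ (2 : ℝ)]
  simp only [hleft, hright]

lemma abs_dyadicMean_sub_dyadicMean_succ (j q : ℕ) :
    |dyadicMean R j q - dyadicMean R (j + 1) (q / 2)| =
      |dyadicMean R j (2 * (q / 2) + 1) - dyadicMean R j (2 * (q / 2))| / 2 := by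
  rw [dyadicMean_succ, ← abs_two, ← abs_div, abs_two]
  rcases Nat.mod_two_eq_zero_or_one q with hq | hq
  · rw [← abs_neg, show dyadicMean R j q = dyadicMean R j (2 * (q / 2)) by congr 1; omega]
    ring_nf
  · rw [show dyadicMean R j q = dyadicMean R j (2 * (q / 2) + 1) by congr 1; omega]
    ring_nf

lemma sq_dyadicMean_sub_le (j q : ℕ) :
    (dyadicMean R j (q + 1) - dyadicMean R j q) ^ 2 ≤
      (∑ k ∈ Finset.range (2 ^ j), (R (2 ^ j * q + k + 2 ^ j) - R (2 ^ j * q + k)) ^ 2) /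
        2 ^ j := by
  have hshift : ∀ k, 2 ^ j * (q + 1) + k = 2 ^ j * q + k + 2 ^ j := fun k => by ring
  simp only [dyadicMean, hshift, ← sub_div, ← Finset.sum_sub_distrib]
  have hmean := sum_div_card_sq_le_sum_sq_div_card (s := Finset.range (2 ^ j))
    (f := fun k => R (2 ^ j * q + k + 2 ^ j) - R (2 ^ j * q + k))
  simpa only [Finset.card_range, Nat.cast_pow, Nat.cast_ofNat] using hmean

lemma dyadic_block_lt {j q r k : ℕ} (hj : j < r) (hq : q < 2 ^ (r - j)) (hk : k < 2 ^ j) :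
    2 ^ j * (2 * (q / 2)) + k < 2 ^ r := by
  obtain ⟨i, rfl⟩ := Nat.exists_eq_add_of_lt hj
  rw [show j + i + 1 - j = i + 1 by omega] at hq
  calc 2 ^ j * (2 * (q / 2)) + k < 2 ^ j * (q + 1) := by
        rw [mul_add_one]
        exact add_lt_add_of_le_of_lt (Nat.mul_le_mul_left _ (Nat.mul_div_le q 2)) hk
    _ ≤ 2 ^ j * 2 ^ (i + 1) := Nat.mul_le_mul_left _ hq
    _ = 2 ^ (j + i + 1) := by rw [← pow_add, add_assoc]

lemma abs_dyadicMean_sub_le_of_sq_le {j q r : ℕ} (hj : j < r) (hq : q < 2 ^ (r - j)) {C : ℝ}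
    (hC : ∀ k < 2 ^ r, (R (k + 2 ^ j) - R k) ^ 2 ≤ C) :
    |dyadicMean R j q - dyadicMean R (j + 1) (q / 2)| ≤ √C / 2 := by
  rw [abs_dyadicMean_sub_dyadicMean_succ]
  refine div_le_div_of_nonneg_right (Real.abs_le_sqrt ?_) zero_le_two
  refine (sq_dyadicMean_sub_le R j _).trans (div_le_of_le_mul₀ (by positivity) ?_ ?_)
  · exact (sq_nonneg _).trans (hC 0 (by positivity))
  · refine (Finset.sum_le_card_nsmul _ _ C fun k hk =>
      hC _ (dyadic_block_lt hj hq (Finset.mem_range.1 hk))).trans_eq ?_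
    rw [Finset.card_range, nsmul_eq_mul, mul_comm, Nat.cast_pow, Nat.cast_ofNat]

lemma abs_dyadicMean_sub_le_sqrt_sum {j q r : ℕ} (hj : j < r) (hq : q < 2 ^ (r - j)) :
    |dyadicMean R j q - dyadicMean R (j + 1) (q / 2)| ≤
      √((∑ k ∈ Finset.range (2 ^ r), (R (k + 2 ^ j) - R k) ^ 2) / 2 ^ j) / 2 := by
  rw [abs_dyadicMean_sub_dyadicMean_succ]
  refine div_le_div_of_nonneg_right (Real.abs_le_sqrt ?_) zero_le_two
  refine (sq_dyadicMean_sub_le R j _).trans (div_le_div_of_nonneg_right ?_ (by positivity))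
  rw [← Finset.sum_image (f := fun k => (R (k + 2 ^ j) - R k) ^ 2)
    (g := fun k => 2 ^ j * (2 * (q / 2)) + k) fun _ _ _ _ h => add_left_cancel h]
  refine Finset.sum_le_sum_of_subset_of_nonneg (Finset.image_subset_iff.2 fun k hk => ?_)
    fun k _ _ => sq_nonneg _
  exact Finset.mem_range.2 (dyadic_block_lt hj hq (Finset.mem_range.1 hk))

variable {R}

lemma abs_sub_dyadicMean_le {r n : ℕ} (hn : n < 2 ^ r) {β : ℕ → ℝ}
    (hβ : ∀ j < r, ∀ q < 2 ^ (r - j),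
      |dyadicMean R j q - dyadicMean R (j + 1) (q / 2)| ≤ β j / 2) :
    |R n - dyadicMean R r 0| ≤ (∑ j ∈ Finset.range r, β j) / 2 := by
  suffices ∀ i ≤ r, |R n - dyadicMean R i (n / 2 ^ i)| ≤ (∑ j ∈ Finset.range i, β j) / 2 by
    simpa [Nat.div_eq_of_lt hn] using this r le_rfl
  intro i hi
  induction i with
  | zero => simp [dyadicMean_zero]
  | succ i ih =>
    have hq : n / 2 ^ i < 2 ^ (r - i) := by
      rwa [Nat.div_lt_iff_lt_mul (by positivity), ← pow_add, Nat.sub_add_cancel (by omega)]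
    have hstep := hβ i hi _ hq
    rw [Nat.div_div_eq_div_mul, ← pow_succ] at hstep
    have htri := abs_sub_le (R n) (dyadicMean R i (n / 2 ^ i))
      (dyadicMean R (i + 1) (n / 2 ^ (i + 1)))
    rw [Finset.sum_range_succ]
    linarith [ih (by omega)]

lemma abs_sub_le_sum_dyadic {r n : ℕ} (hn : n < 2 ^ r) {β : ℕ → ℝ}
    (hβ : ∀ j < r, ∀ q < 2 ^ (r - j),
      |dyadicMean R j q - dyadicMean R (j + 1) (q / 2)| ≤ β j / 2) :
    |R n - R 0| ≤ ∑ j ∈ Finset.range r, β j := by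
  have htri := abs_sub_le (R n) (dyadicMean R r 0) (R 0)
  rw [abs_sub_comm (dyadicMean R r 0)] at htri
  linarith [abs_sub_dyadicMean_le hn hβ, abs_sub_dyadicMean_le (n := 0) (by positivity) hβ]

lemma abs_sub_le_of_dyadic_increments {J r n : ℕ} (hn : n < 2 ^ r) {C : ℝ}
    (hC : ∀ j < J, ∀ k < 2 ^ r, (R (k + 2 ^ j) - R k) ^ 2 ≤ C) :
    |R n - R 0| ≤ J * √C + ∑ j ∈ Finset.Ico J r,
      √((∑ k ∈ Finset.range (2 ^ r), (R (k + 2 ^ j) - R k) ^ 2) / 2 ^ j) := by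
  set g : ℕ → ℝ := fun j => √((∑ k ∈ Finset.range (2 ^ r), (R (k + 2 ^ j) - R k) ^ 2) / 2 ^ j)
  have hsum : |R n - R 0| ≤ ∑ j ∈ Finset.range r, if j < J then √C else g j := by
    refine abs_sub_le_sum_dyadic hn fun j hj q hq => ?_
    split_ifs with hjJ
    · exact abs_dyadicMean_sub_le_of_sq_le R hj hq (hC j hjJ)
    · exact abs_dyadicMean_sub_le_sqrt_sum R hj hq
  refine hsum.trans ?_
  rw [Finset.sum_ite, Finset.sum_const, nsmul_eq_mul]
  refine add_le_add (mul_le_mul_of_nonneg_right (Nat.cast_le.2 ?_) (Real.sqrt_nonneg C))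
    (Finset.sum_le_sum_of_subset_of_nonneg (fun j hj => ?_) fun j _ _ => Real.sqrt_nonneg _)
  · refine (Finset.card_le_card fun j hj => ?_).trans (Finset.card_range J).le
    exact Finset.mem_range.2 (Finset.mem_filter.1 hj).2
  · simp only [Finset.mem_filter, Finset.mem_range, not_lt] at hj
    exact Finset.mem_Ico.2 hj.symm

lemma exists_forall_le_add_mul_of_tendsto_div {u : ℕ → ℕ → ℝ}
    (hu : ∀ j, Tendsto (fun k : ℕ => u j k / k) atTop (𝓝 0)) (J : ℕ) {δ : ℝ} (hδ : 0 < δ) :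
    ∃ M, 0 ≤ M ∧ ∀ j < J, ∀ k, u j k ≤ M + δ * k := by
  have hbdd : ∀ j, BddAbove (Set.range fun k : ℕ => u j k - δ * k) := by
    refine fun j => IsBoundedUnder.bddAbove_range (isBoundedUnder_of_eventually_le (a := 0) ?_)
    filter_upwards [(hu j).eventually_lt_const hδ, eventually_gt_atTop 0] with k hk hk0
    rw [div_lt_iff₀ (Nat.cast_pos.2 hk0)] at hk
    linarith
  choose M hM using hbdd
  obtain ⟨M', hM'⟩ := ((Set.finite_lt_nat J).image M).bddAbove
  refine ⟨max M' 0, le_max_right _ _, fun j hj k => ?_⟩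
  have hjk : u j k - δ * k ≤ M j := hM j ⟨k, rfl⟩
  have hjM : M j ≤ M' := hM' ⟨j, hj, rfl⟩
  linarith [le_max_left M' 0]

lemma sq_sum_sqrt_sum_div_le {w : ℕ → ℝ} (hw : ∀ j, 0 < w j) (s : Finset ℕ)
    (N : ℕ) {ε : ℝ}
    (h : ∑ k ∈ Finset.range N, ∑ j ∈ s, w j / 2 ^ j * (R (k + 2 ^ j) - R k) ^ 2 ≤ ε) :
    (∑ j ∈ s, √((∑ k ∈ Finset.range N, (R (k + 2 ^ j) - R k) ^ 2) / 2 ^ j)) ^ 2 ≤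
      (∑ j ∈ s, (w j)⁻¹) * ε := by
  rw [Finset.sum_comm] at h
  simp only [← Finset.mul_sum] at h
  have hsum : ∀ j, 0 ≤ ∑ k ∈ Finset.range N, (R (k + 2 ^ j) - R k) ^ 2 :=
    fun j => Finset.sum_nonneg fun _ _ => sq_nonneg _
  refine (Finset.sum_sq_le_sum_mul_sum_of_sq_le_mul s (fun j _ => (inv_pos.2 (hw j)).le)
    (fun j _ => mul_nonneg (div_pos (hw j) (by positivity)).le (hsum j)) fun j _ => ?_).trans
    (mul_le_mul_of_nonneg_left h (Finset.sum_nonneg fun j _ => (inv_pos.2 (hw j)).le))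
  rw [Real.sq_sqrt (div_nonneg (hsum j) (by positivity)), ← mul_assoc, ← mul_div_assoc,
    inv_mul_cancel₀ (hw j).ne', one_div_mul_eq_div]

lemma tendsto_div_sqrt_of_forall_sq_le {u a : ℕ → ℝ}
    (h : ∀ η : ℝ, 0 < η → ∀ᶠ n in atTop, u n ^ 2 ≤ η * a n) :
    Tendsto (fun n => u n / √(a n)) atTop (𝓝 0) := by
  rw [Metric.tendsto_nhds]
  intro ε hε
  filter_upwards [h ((ε / 2) ^ 2) (by positivity)] with n hn
  have hle : |u n| ≤ ε / 2 * √(a n) := by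
    rw [← Real.sqrt_sq (half_pos hε).le, ← Real.sqrt_mul (sq_nonneg _)]
    exact Real.abs_le_sqrt hn
  rw [dist_zero_right, Real.norm_eq_abs, abs_div, abs_of_nonneg (Real.sqrt_nonneg _)]
  exact (div_le_of_le_mul₀ (Real.sqrt_nonneg _) (half_pos hε).le hle).trans_lt (half_lt_self hε)

lemma eventually_sq_le_of_dyadic_increments (hR0 : R 0 = 0) {w B : ℕ → ℝ}
    (hw : ∀ j, 0 < w j)
    (hwB : ∀ r n, 2 ^ r ≤ n → ∑ j ∈ Finset.range (r + 1), (w j)⁻¹ ≤ B n)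
    (hR : ∀ j, Tendsto (fun k : ℕ => (R (k + 2 ^ j) - R k) ^ 2 / k) atTop (𝓝 0))
    (hmean : ∀ ε : ℝ, 0 < ε → ∃ J, ∀ N r : ℕ, ∑ k ∈ Finset.range N, ∑ j ∈ Finset.Ico J r,
      w j / 2 ^ j * (R (k + 2 ^ j) - R k) ^ 2 ≤ ε * N) {η : ℝ} (hη : 0 < η) :
    ∀ᶠ n : ℕ in atTop, R n ^ 2 ≤ η * (n * B n) := by
  obtain ⟨J, hJ⟩ := hmean (η / 8) (by positivity)
  set c := (w 0)⁻¹
  have hc0 : 0 < c := inv_pos.2 (hw 0)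
  set δ := η * c / (16 * (J ^ 2 + 1)) with hδ
  have hδJ : 16 * J ^ 2 * δ ≤ η * c := by
    rw [hδ, mul_div_assoc', div_le_iff₀ (by positivity)]
    nlinarith [mul_pos hη hc0]
  obtain ⟨M, hM0, hM⟩ := exists_forall_le_add_mul_of_tendsto_div hR J (δ := δ) (by positivity)
  have hlarge : ∀ᶠ n : ℕ in atTop, 2 * J ^ 2 * M ≤ η * c / 4 * n :=
    (tendsto_natCast_atTop_atTop.const_mul_atTop (by positivity)).eventually_ge_atTop _
  filter_upwards [hlarge, eventually_ge_atTop 1] with n hn hn1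
  set r := Nat.log 2 n
  have hrn : 2 ^ r ≤ n := Nat.pow_log_le_self 2 (by omega)
  have hr2 : ((2 ^ (r + 1) : ℕ) : ℝ) ≤ 2 * n := by
    exact_mod_cast (pow_succ' 2 r).trans_le (Nat.mul_le_mul_left 2 hrn)
  have hcB : c ≤ B n := by simpa using hwB 0 n (by simpa using hn1)
  set g : ℕ → ℝ := fun j =>
    √((∑ k ∈ Finset.range (2 ^ (r + 1)), (R (k + 2 ^ j) - R k) ^ 2) / 2 ^ j)
  have hsmall : |R n - R 0| ≤ J * √(M + 2 * δ * n) + ∑ j ∈ Finset.Ico J (r + 1), g j := by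
    refine abs_sub_le_of_dyadic_increments (Nat.lt_pow_succ_log_self one_lt_two n)
      fun j hj k hk => (hM j hj k).trans ?_
    have hkn : (k : ℝ) ≤ 2 * n := (Nat.cast_le.2 hk.le).trans hr2
    linarith [mul_le_mul_of_nonneg_left hkn (show 0 ≤ δ by positivity)]
  have hlargeScales : (∑ j ∈ Finset.Ico J (r + 1), g j) ^ 2 ≤ B n * (η / 4 * n) := by
    refine (sq_sum_sqrt_sum_div_le hw _ _ (hJ _ _)).trans (mul_le_mul ?_ ?_ ?_ ?_)
    · refine (Finset.sum_le_sum_of_subset_of_nonneg (fun j hj => ?_) fun j _ _ =>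
        (inv_pos.2 (hw j)).le).trans (hwB r n hrn)
      exact Finset.mem_range.2 (Finset.mem_Ico.1 hj).2
    · linarith [mul_le_mul_of_nonneg_left hr2 (show 0 ≤ η / 8 by positivity)]
    · positivity
    · exact hc0.le.trans hcB
  rw [hR0, sub_zero] at hsmall
  have hsq := (pow_le_pow_left₀ (abs_nonneg _) hsmall 2).trans add_sq_le
  rw [sq_abs, mul_pow, Real.sq_sqrt (by positivity)] at hsq
  have hδn := mul_le_mul_of_nonneg_right hδJ n.cast_nonneg
  have hcBn := mul_le_mul_of_nonneg_left hcB (show 0 ≤ η * n by positivity)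
  linarith

end Dyadic

section Maximal

variable {Ω : Type*}

/-- The maximum of the Birkhoff sums of `g` of length at most `N`. The recursion is the one from
which the maximal ergodic lemma is read off. -/
noncomputable def maxBirkhoffSum (T : Ω → Ω) (g : Ω → ℝ) : ℕ → Ω → ℝ
  | 0, _ => 0
  | N + 1, x => max 0 (g x + maxBirkhoffSum T g N (T x))

variable {T : Ω → Ω} {g : Ω → ℝ}

lemma maxBirkhoffSum_nonneg (N : ℕ) (x : Ω) : 0 ≤ maxBirkhoffSum T g N x := by
  cases N with
  | zero => exact le_rfl
  | succ N => exact le_max_left _ _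

lemma maxBirkhoffSum_le_succ (N : ℕ) (x : Ω) :
    maxBirkhoffSum T g N x ≤ maxBirkhoffSum T g (N + 1) x := by
  induction N generalizing x with
  | zero => exact maxBirkhoffSum_nonneg 1 x
  | succ N ih => exact max_le_max le_rfl (add_le_add le_rfl (ih _))

lemma birkhoffSum_le_maxBirkhoffSum {n N : ℕ} (h : n ≤ N) (x : Ω) :
    birkhoffSum T g n x ≤ maxBirkhoffSum T g N x := by
  induction n generalizing N x with
  | zero => simpa using maxBirkhoffSum_nonneg N x
  | succ n ih =>
    obtain ⟨N, rfl⟩ : ∃ M, N = M + 1 := ⟨N - 1, by omega⟩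
    rw [birkhoffSum_succ']
    exact (add_le_add le_rfl (ih (by omega) _)).trans (le_max_right _ _)

lemma maxBirkhoffSum_succ_sub_le_indicator (N : ℕ) (x : Ω) :
    maxBirkhoffSum T g (N + 1) x - maxBirkhoffSum T g N (T x) ≤
      {x | 0 < maxBirkhoffSum T g (N + 1) x}.indicator g x := by
  by_cases hx : 0 < maxBirkhoffSum T g (N + 1) x
  · have hmax : maxBirkhoffSum T g (N + 1) x = g x + maxBirkhoffSum T g N (T x) :=
      max_eq_right ((lt_max_iff.1 hx).resolve_left (lt_irrefl _)).le
    rw [Set.indicator_of_mem (by exact hx), hmax, add_sub_cancel_right]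
  · rw [Set.indicator_of_notMem (by exact hx)]
    linarith [maxBirkhoffSum_nonneg (T := T) (g := g) N (T x)]

variable {mΩ : MeasurableSpace Ω} {P : Measure Ω}

lemma measurable_maxBirkhoffSum (hT : Measurable T) (hg : Measurable g) (N : ℕ) :
    Measurable (maxBirkhoffSum T g N) := by
  induction N with
  | zero => exact measurable_const
  | succ N ih => exact measurable_const.max (hg.add (ih.comp hT))

lemma integrable_maxBirkhoffSum (hT : MeasurePreserving T P P) (hg : Integrable g P) (N : ℕ) :
    Integrable (maxBirkhoffSum T g N) P := by
  induction N with
  | zero => exact integrable_zero _ _ _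
  | succ N ih => exact (integrable_zero _ _ _).sup (hg.add (hT.integrable_comp_of_integrable ih))

/-- Hopf's maximal ergodic lemma. -/
lemma setIntegral_maxBirkhoffSum_pos_nonneg (hT : MeasurePreserving T P P) (hgm : Measurable g)
    (hg : Integrable g P) (N : ℕ) :
    0 ≤ ∫ x in {x | 0 < maxBirkhoffSum T g (N + 1) x}, g x ∂P := by
  have hmeas := measurable_maxBirkhoffSum hT.measurable hgm
  have hint := integrable_maxBirkhoffSum hT hg
  have hpos : MeasurableSet {x | 0 < maxBirkhoffSum T g (N + 1) x} :=
    measurableSet_lt measurable_const (hmeas _)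
  have hcomp : ∫ x, maxBirkhoffSum T g N (T x) ∂P = ∫ x, maxBirkhoffSum T g N x ∂P := by
    conv_rhs => rw [← hT.map_eq]
    exact (integral_map hT.measurable.aemeasurable (hmeas N).aestronglyMeasurable).symm
  have hintT : Integrable (fun x => maxBirkhoffSum T g N (T x)) P :=
    hT.integrable_comp_of_integrable (hint N)
  rw [← integral_indicator hpos]
  calc 0 ≤ ∫ x, maxBirkhoffSum T g (N + 1) x ∂P - ∫ x, maxBirkhoffSum T g N (T x) ∂P := by
        rw [hcomp, sub_nonneg]
        exact integral_mono (hint _) (hint _) (maxBirkhoffSum_le_succ N)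
    _ = ∫ x, (maxBirkhoffSum T g (N + 1) x - maxBirkhoffSum T g N (T x)) ∂P :=
        (integral_sub (hint _) hintT).symm
    _ ≤ _ := integral_mono ((hint _).sub hintT) (hg.indicator hpos)
        (maxBirkhoffSum_succ_sub_le_indicator N)

lemma measureReal_birkhoffSum_gt_le [IsFiniteMeasure P] (hT : MeasurePreserving T P P)
    (hgm : Measurable g) (hg : Integrable g P) (hg0 : 0 ≤ g) {c : ℝ} (hc : 0 < c) (N : ℕ) :
    P.real {x | ∃ n ≤ N, c * n < birkhoffSum T g n x} ≤ (∫ x, g x ∂P) / c := by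
  set g' : Ω → ℝ := fun x => g x - c with hg'
  set A := {x | 0 < maxBirkhoffSum T g' (N + 1) x}
  have hsub : {x | ∃ n ≤ N, c * n < birkhoffSum T g n x} ⊆ A := by
    rintro x ⟨n, hn, hx⟩
    have hmax := birkhoffSum_le_maxBirkhoffSum (T := T) (g := g') (hn.trans N.le_succ) x
    have hsum : birkhoffSum T g' n x = birkhoffSum T g n x - c * n := by
      simp [birkhoffSum, hg', mul_comm]
    exact (sub_pos.2 hx).trans_le (hsum ▸ hmax)
  have hHopf : 0 ≤ ∫ x in A, g' x ∂P :=
    setIntegral_maxBirkhoffSum_pos_nonneg hT (hgm.sub_const c) (hg.sub (integrable_const c)) N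
  rw [integral_sub hg.integrableOn (integrable_const c).integrableOn, setIntegral_const,
    smul_eq_mul, sub_nonneg] at hHopf
  rw [le_div_iff₀ hc]
  calc P.real {x | ∃ n ≤ N, c * n < birkhoffSum T g n x} * c
      ≤ P.real A * c := mul_le_mul_of_nonneg_right (measureReal_mono hsub) hc.le
    _ ≤ ∫ x in A, g x ∂P := hHopf
    _ ≤ ∫ x, g x ∂P := setIntegral_le_integral hg (Eventually.of_forall hg0)

lemma ae_eventually_comp_iterate_le [IsProbabilityMeasure P] (hT : MeasurePreserving T P P)
    (hg : Integrable g P) (hg0 : 0 ≤ g) :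
    ∀ᵐ x ∂P, ∀ᶠ k : ℕ in atTop, g (T^[k] x) ≤ k := by
  have htail : ∀ k : ℕ, P {x | (k : ℝ) < g (T^[k] x)} = P {x | g x ∈ Set.Ioi (k : ℝ)} :=
    fun k => (hT.iterate k).measure_preimage
      (nullMeasurableSet_lt aemeasurable_const hg.aemeasurable)
  have hsum : ∑' k : ℕ, P {x | (k : ℝ) < g (T^[k] x)} ≠ ∞ := by
    simp_rw [htail]
    let _ : MeasureSpace Ω := ⟨P⟩
    have _ : IsProbabilityMeasure (volume : Measure Ω) := ‹IsProbabilityMeasure P›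
    exact (tsum_prob_mem_Ioi_lt_top hg hg0).ne
  filter_upwards [ae_eventually_notMem hsum] with x hx
  filter_upwards [hx] with k hk using not_lt.1 hk

lemma ae_tendsto_comp_iterate_div [IsProbabilityMeasure P] (hT : MeasurePreserving T P P)
    (hg : Integrable g P) (hg0 : 0 ≤ g) :
    ∀ᵐ x ∂P, Tendsto (fun k : ℕ => g (T^[k] x) / (k : ℝ)) atTop (𝓝 0) := by
  have hev : ∀ m : ℕ, ∀ᵐ x ∂P, ∀ᶠ k : ℕ in atTop, ((m : ℝ) + 1) * g (T^[k] x) ≤ k := fun m =>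
    ae_eventually_comp_iterate_le hT (hg.const_mul _) fun x => mul_nonneg (by positivity) (hg0 x)
  filter_upwards [ae_all_iff.2 hev] with x hx
  rw [Metric.tendsto_nhds]
  intro ε hε
  obtain ⟨m, hm⟩ := exists_nat_one_div_lt hε
  filter_upwards [hx m, eventually_gt_atTop 0] with k hk hk0
  have hk0' : (0 : ℝ) < k := Nat.cast_pos.2 hk0
  rw [dist_zero_right, Real.norm_of_nonneg (div_nonneg (hg0 _) hk0'.le), div_lt_iff₀ hk0']
  calc g (T^[k] x) ≤ 1 / (m + 1) * k := by
        rw [one_div_mul_eq_div, le_div_iff₀' (by positivity)]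
        exact hk
    _ < ε * k := by gcongr

section SummableFamily

variable [IsFiniteMeasure P] {G : ℕ → Ω → ℝ}

lemma measure_exists_sum_gt_le (hT : MeasurePreserving T P P) (hGm : ∀ j, Measurable (G j))
    (hGi : ∀ j, Integrable (G j) P) (hG0 : ∀ j, 0 ≤ G j)
    (hsum : Summable fun j => ∫ x, G j x ∂P) {ε : ℝ} (hε : 0 < ε) :
    P {x | ∃ N r : ℕ, ε * N < ∑ k ∈ Finset.range N, ∑ j ∈ Finset.range r, G j (T^[k] x)} ≤
      ENNReal.ofReal ((∑' j, ∫ x, G j x ∂P) / ε) := by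
  set g : ℕ → Ω → ℝ := fun r x => ∑ j ∈ Finset.range r, G j x
  have hg0 : ∀ r, 0 ≤ g r := fun r x => Finset.sum_nonneg fun j _ => hG0 j x
  have hgmono : ∀ {r r'}, r ≤ r' → ∀ x, g r x ≤ g r' x := fun h x =>
    Finset.sum_le_sum_of_subset_of_nonneg (Finset.range_mono h) fun j _ _ => hG0 j x
  set A : ℕ → Set Ω := fun r => {x | ∃ n ≤ r, ε * n < birkhoffSum T (g r) n x}
  have hAmono : Monotone A := by
    rintro r r' h x ⟨n, hn, hx⟩
    exact ⟨n, hn.trans h, hx.trans_le (Finset.sum_le_sum fun k _ => hgmono h _)⟩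
  have hAle : ∀ r, P (A r) ≤ ENNReal.ofReal ((∑' j, ∫ x, G j x ∂P) / ε) := by
    intro r
    rw [← ofReal_measureReal]
    refine ENNReal.ofReal_le_ofReal ((measureReal_birkhoffSum_gt_le hT
      (Finset.measurable_fun_sum _ fun j _ => hGm j) (integrable_finsetSum _ fun j _ => hGi j)
      (hg0 r) hε r).trans (div_le_div_of_nonneg_right ?_ hε.le))
    rw [integral_finsetSum _ fun j _ => hGi j]
    exact hsum.sum_le_tsum _ fun j _ => integral_nonneg (hG0 j)
  refine (measure_mono ?_).trans (hAmono.measure_iUnion.trans_le (iSup_le hAle))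
  rintro x ⟨N, r, hx⟩
  exact Set.mem_iUnion.2 ⟨max N r, N, le_max_left _ _,
    hx.trans_le (Finset.sum_le_sum fun k _ => hgmono (le_max_right _ _) _)⟩

lemma ae_exists_forall_sum_le_of_pos (hT : MeasurePreserving T P P)
    (hGm : ∀ j, Measurable (G j)) (hGi : ∀ j, Integrable (G j) P) (hG0 : ∀ j, 0 ≤ G j)
    (hsum : Summable fun j => ∫ x, G j x ∂P) {ε : ℝ} (hε : 0 < ε) :
    ∀ᵐ x ∂P, ∃ J, ∀ N r : ℕ, ∑ k ∈ Finset.range N, ∑ j ∈ Finset.Ico J r,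
      G j (T^[k] x) ≤ ε * N := by
  have htail : ∀ J, P {x | ∀ J, ∃ N r : ℕ, ε * N < ∑ k ∈ Finset.range N,
      ∑ j ∈ Finset.Ico J r, G j (T^[k] x)} ≤
        ENNReal.ofReal ((∑' j, ∫ x, G (j + J) x ∂P) / ε) := by
    refine fun J => (measure_mono fun x hx => ?_).trans (measure_exists_sum_gt_le hT
      (fun j => hGm (j + J)) (fun j => hGi (j + J)) (fun j => hG0 (j + J))
      ((summable_nat_add_iff J).2 hsum) hε)
    obtain ⟨N, r, h⟩ := hx J
    refine ⟨N, r - J, h.trans_eq (Finset.sum_congr rfl fun k _ => ?_)⟩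
    simp only [Finset.sum_Ico_eq_sum_range, add_comm J]
  have htendsto : Tendsto (fun J => ENNReal.ofReal ((∑' j, ∫ x, G (j + J) x ∂P) / ε)) atTop
      (𝓝 0) := by
    have := (tendsto_sum_nat_add fun j => ∫ x, G j x ∂P).div_const ε
    simpa only [zero_div, ENNReal.ofReal_zero] using ENNReal.tendsto_ofReal this
  rw [ae_iff]
  simp only [not_exists, not_forall, not_le]
  exact le_antisymm (ge_of_tendsto' htendsto htail) zero_le

lemma ae_exists_forall_sum_le (hT : MeasurePreserving T P P)
    (hGm : ∀ j, Measurable (G j)) (hGi : ∀ j, Integrable (G j) P) (hG0 : ∀ j, 0 ≤ G j)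
    (hsum : Summable fun j => ∫ x, G j x ∂P) :
    ∀ᵐ x ∂P, ∀ ε : ℝ, 0 < ε → ∃ J, ∀ N r : ℕ, ∑ k ∈ Finset.range N, ∑ j ∈ Finset.Ico J r,
      G j (T^[k] x) ≤ ε * N := by
  have hall : ∀ᵐ x ∂P, ∀ m : ℕ, ∃ J, ∀ N r : ℕ, ∑ k ∈ Finset.range N, ∑ j ∈ Finset.Ico J r,
      G j (T^[k] x) ≤ 1 / ((m : ℝ) + 1) * N :=
    ae_all_iff.2 fun m => ae_exists_forall_sum_le_of_pos hT hGm hGi hG0 hsum (by positivity)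
  filter_upwards [hall] with x hx ε hε
  obtain ⟨m, hm⟩ := exists_nat_one_div_lt hε
  obtain ⟨J, hJ⟩ := hx m
  exact ⟨J, fun N r => (hJ N r).trans (by gcongr)⟩

end SummableFamily

theorem ae_tendsto_birkhoffSum_div_sqrt [IsProbabilityMeasure P] (hT : MeasurePreserving T P P)
    (hgm : Measurable g) (hg : MemLp g 2 P) {w B : ℕ → ℝ} (hw : ∀ j, 0 < w j)
    (hwB : ∀ r n, 2 ^ r ≤ n → ∑ j ∈ Finset.range (r + 1), (w j)⁻¹ ≤ B n)
    (hsum : Summable fun j => w j / 2 ^ j * ∫ x, birkhoffSum T g (2 ^ j) x ^ 2 ∂P) :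
    ∀ᵐ x ∂P, Tendsto (fun n : ℕ => birkhoffSum T g n x / √(n * B n)) atTop (𝓝 0) := by
  have hsq_meas : ∀ n, Measurable fun x => birkhoffSum T g n x ^ 2 := fun n =>
    (Finset.measurable_fun_sum _ fun k _ => hgm.comp (hT.measurable.iterate k)).pow_const 2
  have hsq_int : ∀ n, Integrable (fun x => birkhoffSum T g n x ^ 2) P := fun n =>
    (memLp_finsetSum (Finset.range n) (f := fun k x => g (T^[k] x))
      fun k _ => hg.comp_measurePreserving (hT.iterate k)).integrable_sq
  have hincr : ∀ x k j, birkhoffSum T g (k + 2 ^ j) x - birkhoffSum T g k x =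
      birkhoffSum T g (2 ^ j) (T^[k] x) := fun x k j => by
    rw [birkhoffSum_add, add_sub_cancel_left]
  have hmean := ae_exists_forall_sum_le hT
    (G := fun j x => w j / 2 ^ j * birkhoffSum T g (2 ^ j) x ^ 2)
    (fun j => (hsq_meas _).const_mul _) (fun j => (hsq_int _).const_mul _)
    (fun j x => mul_nonneg (div_pos (hw j) (by positivity)).le (sq_nonneg _))
    (by simpa only [integral_const_mul] using hsum)
  filter_upwards [hmean, ae_all_iff.2 fun j => ae_tendsto_comp_iterate_div hT (hsq_int (2 ^ j))
    fun x => sq_nonneg _] with x hx_mean hx_incr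
  refine tendsto_div_sqrt_of_forall_sq_le fun η => eventually_sq_le_of_dyadic_increments
    (R := fun n => birkhoffSum T g n x) (birkhoffSum_zero _ _ _) hw hwB ?_ ?_
  · simpa only [hincr] using hx_incr
  · simpa only [hincr] using hx_mean

end Maximal

section Weights

variable {b τ : ℕ → ℝ}

/-- Weights on the dyadic scales such that `∑_{2 ^ j ≤ n} 1 / w_j ≤ b*_n`. Reading `b` at
`2 ^ (j - 1)`, where `w_0 = 3 b_1` by truncation, makes the scale `j` comparable with the terms of
the projective condition in the preceding block, without any regularity of `b`. -/
def dyadicWeight (b : ℕ → ℝ) (j : ℕ) : ℝ := 3 * b (2 ^ (j - 1))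

lemma dyadicWeight_pos (hb_pos : ∀ n : ℕ, 1 ≤ n → 0 < b n) (j : ℕ) : 0 < dyadicWeight b j :=
  mul_pos three_pos (hb_pos _ Nat.one_le_two_pow)

lemma bStar_le_bStar (hb_pos : ∀ n : ℕ, 1 ≤ n → 0 < b n) {m n : ℕ} (h : m ≤ n) :
    bStar b m ≤ bStar b n :=
  Finset.sum_le_sum_of_subset_of_nonneg (Finset.Icc_subset_Icc le_rfl h) fun k hk _ =>
    inv_nonneg.2 (mul_nonneg k.cast_nonneg (hb_pos k (Finset.mem_Icc.1 hk).1).le)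

lemma sum_inv_two_pow_le_bStar (hb_pos : ∀ n : ℕ, 1 ≤ n → 0 < b n)
    (hb_mono : ∀ m n : ℕ, 1 ≤ m → m ≤ n → b m ≤ b n) (r : ℕ) :
    ∑ i ∈ Finset.range (r + 1), (b (2 ^ i))⁻¹ ≤ 2 * bStar b (2 ^ r) := by
  have hanti : ∀ ⦃m n : ℕ⦄, 1 < m → m ≤ n → ((n : ℝ) * b n)⁻¹ ≤ ((m : ℝ) * b m)⁻¹ := by
    intro m n hm hmn
    have hbm := hb_pos m hm.le
    have hmono := hb_mono m n hm.le hmn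
    have hm0 : (0 : ℝ) < m := Nat.cast_pos.2 (by omega)
    gcongr
  have hcond := Finset.sum_condensed_le hanti r
  have hterm : ∀ i : ℕ, 2 ^ i • (((2 ^ i : ℕ) : ℝ) * b (2 ^ i))⁻¹ = (b (2 ^ i))⁻¹ := fun i => by
    rw [nsmul_eq_mul, mul_inv, mul_inv_cancel_left₀ (by positivity)]
  have hstar : bStar b (2 ^ r) =
      (((1 : ℕ) : ℝ) * b 1)⁻¹ + ∑ k ∈ Finset.Ico (2 : ℕ) (2 ^ r + 1), ((k : ℝ) * b k)⁻¹ :=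
    Finset.sum_eq_sum_Ico_succ_bot (Nat.lt_succ_of_le Nat.one_le_two_pow) _
  have hfirst : 0 < (((1 : ℕ) : ℝ) * b 1)⁻¹ := by simpa using hb_pos 1 le_rfl
  simp only [hterm, two_nsmul] at hcond
  linarith

lemma sum_inv_dyadicWeight_le_bStar (hb_pos : ∀ n : ℕ, 1 ≤ n → 0 < b n)
    (hb_mono : ∀ m n : ℕ, 1 ≤ m → m ≤ n → b m ≤ b n) {r n : ℕ} (hn : 2 ^ r ≤ n) :
    ∑ j ∈ Finset.range (r + 1), (dyadicWeight b j)⁻¹ ≤ bStar b n := by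
  have hsum : ∑ i ∈ Finset.range r, (b (2 ^ i))⁻¹ ≤ 2 * bStar b n := by
    refine le_trans ?_ ((sum_inv_two_pow_le_bStar hb_pos hb_mono r).trans
      (mul_le_mul_of_nonneg_left (bStar_le_bStar hb_pos hn) zero_le_two))
    exact Finset.sum_le_sum_of_subset_of_nonneg (Finset.range_mono r.le_succ)
      fun i _ _ => inv_nonneg.2 (hb_pos _ Nat.one_le_two_pow).le
  have hfirst : (b 1)⁻¹ ≤ bStar b n := by
    simpa [bStar] using bStar_le_bStar hb_pos (Nat.one_le_two_pow.trans hn)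
  simp only [dyadicWeight, mul_inv, ← Finset.mul_sum, Finset.sum_range_succ',
    Nat.add_sub_cancel, Nat.zero_sub, pow_zero]
  linarith

lemma mul_sq_two_pow_le_sum_Ico (hb_pos : ∀ n : ℕ, 1 ≤ n → 0 < b n)
    (hb_mono : ∀ m n : ℕ, 1 ≤ m → m ≤ n → b m ≤ b n) (hτ0 : ∀ n, 0 ≤ τ n)
    (hτ : ∀ m n : ℕ, 1 ≤ m → m ≤ n → τ n ≤ τ m) (s : ℕ) :
    b (2 ^ s) * τ (2 ^ (s + 1)) ^ 2 ≤
      2 * ∑ n ∈ Finset.Ico (2 ^ s) (2 ^ (s + 1)), b n / n * τ n ^ 2 := by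
  have hterm : ∀ n ∈ Finset.Ico (2 ^ s) (2 ^ (s + 1)),
      b (2 ^ s) / 2 ^ (s + 1) * τ (2 ^ (s + 1)) ^ 2 ≤ b n / n * τ n ^ 2 := by
    intro n hn
    obtain ⟨hsn, hns⟩ := Finset.mem_Ico.1 hn
    have hn1 : 1 ≤ n := Nat.one_le_two_pow.trans hsn
    have hn0 : (0 : ℝ) < n := Nat.cast_pos.2 hn1
    have hn2 : (n : ℝ) ≤ 2 ^ (s + 1) := by exact_mod_cast hns.le
    have hbn := hb_mono _ n Nat.one_le_two_pow hsn
    have hτn := hτ n _ hn1 hns.le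
    have hb0 := hb_pos n hn1
    have hτs := hτ0 (2 ^ (s + 1))
    gcongr
  have hcard : 2 ^ (s + 1) - 2 ^ s = 2 ^ s := by rw [pow_succ, mul_two, Nat.add_sub_cancel]
  have hblock := Finset.card_nsmul_le_sum _ _ _ hterm
  rw [Nat.card_Ico, hcard, nsmul_eq_mul, Nat.cast_pow, Nat.cast_ofNat] at hblock
  refine le_trans (le_of_eq ?_) (mul_le_mul_of_nonneg_left hblock zero_le_two)
  field_simp
  ring

lemma summable_dyadicWeight_mul_sq (hb_pos : ∀ n : ℕ, 1 ≤ n → 0 < b n)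
    (hb_mono : ∀ m n : ℕ, 1 ≤ m → m ≤ n → b m ≤ b n) (hτ0 : ∀ n, 0 ≤ τ n)
    (hτ : ∀ m n : ℕ, 1 ≤ m → m ≤ n → τ n ≤ τ m)
    (hsum : Summable fun n : ℕ => b n / n * τ n ^ 2) :
    Summable fun j => dyadicWeight b j * τ (2 ^ j) ^ 2 := by
  have hterm0 : ∀ n : ℕ, 0 ≤ b n / n * τ n ^ 2 := fun n => by
    rcases n.eq_zero_or_pos with rfl | hn
    · simp
    · exact mul_nonneg (div_pos (hb_pos n hn) (Nat.cast_pos.2 hn)).le (sq_nonneg _)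
  rw [← summable_nat_add_iff 1]
  simp only [dyadicWeight, mul_assoc, Nat.add_sub_cancel]
  refine Summable.mul_left 3 (summable_of_sum_range_le (c := 2 * ∑' n : ℕ, b n / n * τ n ^ 2)
    (fun s => mul_nonneg (hb_pos _ Nat.one_le_two_pow).le (sq_nonneg _)) fun r => ?_)
  refine (Finset.sum_le_sum fun s _ =>
    mul_sq_two_pow_le_sum_Ico hb_pos hb_mono hτ0 hτ s).trans ?_
  rw [← Finset.mul_sum, Finset.range_eq_Ico,
    sum_sum_Ico_of_monotone (pow_right_mono₀ one_le_two) _ r.zero_le]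
  exact mul_le_mul_of_nonneg_left (hsum.sum_le_tsum _ fun n _ => hterm0 n) zero_le_two

lemma tendsto_zero_of_summable_dyadicWeight_mul_sq (hb_pos : ∀ n : ℕ, 1 ≤ n → 0 < b n)
    (hb_mono : ∀ m n : ℕ, 1 ≤ m → m ≤ n → b m ≤ b n) {t : ℕ → ℝ}
    (hsum : Summable fun j => dyadicWeight b j * t j ^ 2) : Tendsto t atTop (𝓝 0) := by
  have hb1 : 0 < 3 * b 1 := mul_pos three_pos (hb_pos 1 le_rfl)
  have hsq : Summable fun j => 3 * b 1 * t j ^ 2 :=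
    hsum.of_nonneg_of_le (fun j => mul_nonneg hb1.le (sq_nonneg _)) fun j =>
      mul_le_mul_of_nonneg_right (mul_le_mul_of_nonneg_left
        (hb_mono _ _ le_rfl Nat.one_le_two_pow) zero_le_three) (sq_nonneg _)
  have hlim := ((summable_mul_left_iff hb1.ne').1 hsq).tendsto_atTop_zero.sqrt
  simp only [Real.sqrt_sq_eq_abs, Real.sqrt_zero] at hlim
  exact (tendsto_zero_iff_abs_tendsto_zero t).2 hlim

end Weights

section ProjectiveCondition

variable {Ω : Type*} {mΩ : MeasurableSpace Ω} {P : Measure Ω} {𝒢 : MeasurableSpace Ω}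
  {X : ℤ → Ω → ℝ} {b : ℕ → ℝ}

lemma projTail_antitone : Antitone (projTail P 𝒢 X) := fun _ _ h =>
  ENNReal.tsum_mono_subtype
    (fun k : ℕ => eLpNorm (P[partialSum X k | 𝒢]) 2 P / (k : ℝ≥0∞) ^ (3 / 2 : ℝ))
    (Set.Ici_subset_Ici.2 h)

namespace ProjectiveCondition

lemma projTail_ne_top (hcond : ProjectiveCondition P 𝒢 X b) (hb : 0 < b 1) {n : ℕ} (hn : 1 ≤ n) :
    projTail P 𝒢 X n ≠ ∞ := by
  refine ne_top_of_le_ne_top (fun htop => ?_) (projTail_antitone hn)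
  have hterm := ENNReal.ne_top_of_tsum_ne_top hcond.ne ⟨1, Set.mem_Ici.2 le_rfl⟩
  simp [htop, hb] at hterm

lemma summable (hcond : ProjectiveCondition P 𝒢 X b) (hb_pos : ∀ n : ℕ, 1 ≤ n → 0 < b n) :
    Summable fun n : ℕ => b n / n * (projTail P 𝒢 X n).toReal ^ 2 := by
  rw [ProjectiveCondition, tsum_subtype (Set.Ici (1 : ℕ)) fun n : ℕ =>
    ENNReal.ofReal (b n / (n : ℝ)) * projTail P 𝒢 X n ^ 2] at hcond
  refine (ENNReal.summable_toReal hcond.ne).congr fun n => ?_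
  rcases n.eq_zero_or_pos with rfl | hn
  · simp
  · have hbn : 0 ≤ b n / n := (div_pos (hb_pos n hn) (Nat.cast_pos.2 hn)).le
    rw [Set.indicator_of_mem (by exact hn), ENNReal.toReal_mul, ENNReal.toReal_ofReal hbn,
      ENNReal.toReal_pow]

lemma summable_dyadicWeight (hcond : ProjectiveCondition P 𝒢 X b)
    (hb_pos : ∀ n : ℕ, 1 ≤ n → 0 < b n) (hb_mono : ∀ m n : ℕ, 1 ≤ m → m ≤ n → b m ≤ b n) :
    Summable fun j => dyadicWeight b j * (projTail P 𝒢 X (2 ^ j)).toReal ^ 2 :=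
  summable_dyadicWeight_mul_sq (τ := fun n => (projTail P 𝒢 X n).toReal) hb_pos hb_mono
    (fun _ => ENNReal.toReal_nonneg)
    (fun _ _ hm hmn => ENNReal.toReal_mono (hcond.projTail_ne_top (hb_pos 1 le_rfl) hm)
      (projTail_antitone hmn)) (hcond.summable hb_pos)

end ProjectiveCondition

end ProjectiveCondition

section ConditionalExpectation

variable {Ω : Type*} {𝒢 mΩ : MeasurableSpace Ω} {P : Measure Ω}

lemma condExp_comp_comap {Ω' : Type*} {m mΩ' : MeasurableSpace Ω'} {P' : Measure Ω'}
    [IsFiniteMeasure P] [IsFiniteMeasure P'] {φ : Ω → Ω'} (hφ : MeasurePreserving φ P P')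
    (hm : m ≤ mΩ') {Y : Ω' → ℝ} (hY : Integrable Y P') :
    P[Y ∘ φ | m.comap φ] =ᵐ[P] P'[Y | m] ∘ φ := by
  have hm' : m.comap φ ≤ mΩ := (MeasurableSpace.comap_mono hm).trans hφ.measurable.comap_le
  have hset : ∀ {s : Set Ω'} {Z : Ω' → ℝ}, MeasurableSet[m] s → Integrable Z P' →
      ∫ x in φ ⁻¹' s, (Z ∘ φ) x ∂P = ∫ x in s, Z x ∂P' := by
    intro s Z hs hZ
    rw [← hφ.map_eq] at hZ ⊢
    exact (setIntegral_map (hm s hs) hZ.aestronglyMeasurable hφ.measurable.aemeasurable).symm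
  refine (ae_eq_condExp_of_forall_setIntegral_eq hm' (hφ.integrable_comp_of_integrable hY)
    (fun _ _ _ => (hφ.integrable_comp_of_integrable integrable_condExp).integrableOn) ?_
    (stronglyMeasurable_condExp.comp_measurable (comap_measurable φ)).aestronglyMeasurable).symm
  rintro _ ⟨s, hs, rfl⟩ _
  rw [hset hs integrable_condExp, hset hs hY, setIntegral_condExp hm hY hs]

lemma norm_sq_eq_integral_sq {f : Lp ℝ 2 P} {g : Ω → ℝ} (h : f =ᵐ[P] g) :
    ‖f‖ ^ 2 = ∫ x, g x ^ 2 ∂P := by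
  rw [← real_inner_self_eq_norm_sq, L2.inner_def]
  refine integral_congr_ae ?_
  filter_upwards [h] with x hx
  rw [hx, real_inner_self_eq_norm_sq, Real.norm_eq_abs, sq_abs]

lemma starProjection_lpMeas_coeFn [IsFiniteMeasure P] [hle : Fact (𝒢 ≤ mΩ)]
    {f : Lp ℝ 2 P} {g : Ω → ℝ} (h : f =ᵐ[P] g) :
    (lpMeas ℝ ℝ 𝒢 2 P).starProjection f =ᵐ[P] P[g | 𝒢] := by
  have hg : MemLp g 2 P := (memLp_congr_ae h).1 (Lp.memLp f)
  obtain rfl : f = hg.toLp g := Lp.ext (h.trans hg.coeFn_toLp.symm)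
  exact hg.condExpL2_ae_eq_condExp (𝕜 := ℝ) hle.out

lemma isDyadicTailBound_projTail [IsFiniteMeasure P] [Fact (𝒢 ≤ mΩ)]
    {V : Lp ℝ 2 P →ₗᵢ[ℝ] Lp ℝ 2 P} {x : Lp ℝ 2 P} {X : ℤ → Ω → ℝ}
    (hX : ∀ k, orbitSum V k x =ᵐ[P] partialSum X k) (hfin : projTail P 𝒢 X 1 ≠ ∞) :
    IsDyadicTailBound (fun k => ‖(lpMeas ℝ ℝ 𝒢 2 P).starProjection (orbitSum V k x)‖)
      fun s => (projTail P 𝒢 X (2 ^ s)).toReal := by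
  intro s N
  rw [← ENNReal.ofReal_le_iff_le_toReal
      (ne_top_of_le_ne_top hfin (projTail_antitone Nat.one_le_two_pow)),
    ENNReal.ofReal_sum_of_nonneg fun _ _ => by positivity]
  set a : ℕ → ℝ≥0∞ := fun k => eLpNorm (P[partialSum X k | 𝒢]) 2 P / (k : ℝ≥0∞) ^ (3 / 2 : ℝ)
  have hterm : ∀ k ∈ Finset.Ico (2 ^ s) N, ENNReal.ofReal
      (‖(lpMeas ℝ ℝ 𝒢 2 P).starProjection (orbitSum V k x)‖ / (k : ℝ) ^ (3 / 2 : ℝ)) =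
        (Set.Ici (2 ^ s)).indicator a k := by
    intro k hk
    have hsk := (Finset.mem_Ico.1 hk).1
    have hk0 : (0 : ℝ) < k := Nat.cast_pos.2 (Nat.one_le_two_pow.trans hsk)
    rw [Set.indicator_of_mem (Set.mem_Ici.2 hsk), ENNReal.ofReal_div_of_pos (by positivity),
      ← ENNReal.ofReal_rpow_of_pos hk0, ENNReal.ofReal_natCast, ofReal_norm, Lp.enorm_def,
      eLpNorm_congr_ae (starProjection_lpMeas_coeFn (hX k))]
  rw [Finset.sum_congr rfl hterm, projTail, tsum_subtype (Set.Ici (2 ^ s)) a]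
  exact ENNReal.sum_le_tsum _

end ConditionalExpectation

section Koopman

variable {Ω : Type*} {ℱ₀ mΩ : MeasurableSpace Ω} {P : Measure Ω}

/-- The Koopman operator `f ↦ f ∘ T` of a measure preserving map, as an isometry of real `L²`. -/
noncomputable abbrev koopman {T : Ω → Ω} (hT : MeasurePreserving T P P) :
    Lp ℝ 2 P →ₗᵢ[ℝ] Lp ℝ 2 P :=
  Lp.compMeasurePreservingₗᵢ ℝ T hT

lemma koopman_coeFn {T : Ω → Ω} (hT : MeasurePreserving T P P) {f : Lp ℝ 2 P} {g : Ω → ℝ}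
    (h : f =ᵐ[P] g) : koopman hT f =ᵐ[P] g ∘ T :=
  (Lp.coeFn_compMeasurePreserving f hT).trans (hT.quasiMeasurePreserving.ae_eq_comp h)

lemma orbitSum_koopman_coeFn {T : Ω → Ω} (hT : MeasurePreserving T P P) {f : Lp ℝ 2 P}
    {g : Ω → ℝ} (h : f =ᵐ[P] g) (n : ℕ) :
    orbitSum (koopman hT) n f =ᵐ[P] birkhoffSum T g n := by
  induction n with
  | zero =>
    rw [orbitSum_zero, birkhoffSum_zero']
    exact Lp.coeFn_zero ℝ 2 P
  | succ n ih =>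
    rw [orbitSum_succ']
    filter_upwards [Lp.coeFn_add f (koopman hT (orbitSum (koopman hT) n f)), h,
      koopman_coeFn hT ih] with x hadd hf hV
    rw [hadd, Pi.add_apply, hf, hV, birkhoffSum_succ', Function.comp_apply]

lemma lpMeas_le_map_koopman {T : Ω ≃ᵐ Ω} (hT : MeasurePreserving T P P)
    (hℱ : ℱ₀ ≤ ℱ₀.comap T) :
    lpMeas ℝ ℝ ℱ₀ 2 P ≤ (lpMeas ℝ ℝ ℱ₀ 2 P).map (koopman hT).toLinearMap := by
  intro f hf
  obtain ⟨g, hg, hfg⟩ := mem_lpMeas_iff_aestronglyMeasurable.1 hf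
  have hsymm : Measurable[ℱ₀, ℱ₀] T.symm := fun s hs => by
    obtain ⟨A, hA, rfl⟩ := hℱ s hs
    rwa [← Set.preimage_comp, T.self_comp_symm, Set.preimage_id]
  have hmem : MemLp (g ∘ T.symm) 2 P :=
    ((memLp_congr_ae hfg).1 (Lp.memLp f)).comp_measurePreserving (hT.symm T)
  refine ⟨hmem.toLp _, mem_lpMeas_iff_aestronglyMeasurable.2
    ⟨_, hg.comp_measurable hsymm, hmem.coeFn_toLp⟩, Lp.ext ?_⟩
  refine (koopman_coeFn hT hmem.coeFn_toLp).trans ?_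
  rw [Function.comp_assoc, T.symm_comp_self, Function.comp_id]
  exact hfg.symm

end Koopman

section Transformation

variable {Ω : Type*} {ℱ₀ mΩ : MeasurableSpace Ω} {P : Measure Ω} {T : Ω ≃ᵐ Ω} {b : ℕ → ℝ}

lemma iter_zero (T : Ω ≃ᵐ Ω) : iter T 0 = id := by
  funext ω
  simp [iter]

lemma iter_natCast (T : Ω ≃ᵐ Ω) (n : ℕ) : iter T (n : ℤ) = T^[n] := by
  induction n with
  | zero => exact iter_zero T
  | succ n ih => rw [Nat.cast_succ, iter_add_one, ih, ← Function.iterate_succ']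

lemma iter_add_apply (T : Ω ≃ᵐ Ω) (k m : ℤ) (ω : Ω) : iter T (k + m) ω = iter T k (iter T m ω) := by
  simp [iter, zpow_add, Equiv.Perm.mul_apply]

lemma measurePreserving_iter (hT : MeasurePreserving T P P) (k : ℤ) :
    MeasurePreserving (iter T k) P P := by
  induction k using Int.induction_on with
  | zero => rw [iter_zero]; exact MeasurePreserving.id P
  | succ i ih => rw [iter_add_one]; exact hT.comp ih
  | pred i ih => rw [iter_sub_one]; exact (hT.symm T).comp ih

lemma partialSum_iter (T : Ω ≃ᵐ Ω) (g : Ω → ℝ) (n : ℕ) :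
    partialSum (fun i ω => g (iter T i ω)) n = birkhoffSum T g n := by
  funext ω
  simp only [partialSum, birkhoffSum, iter_natCast]

lemma stationaryProcess_iter (hT : MeasurePreserving T P P) {g : Ω → ℝ} (hg : Measurable g) :
    StationaryProcess P fun k ω => g (iter T k ω) := by
  intro m
  have hpath : Measurable fun (ω : Ω) (k : ℤ) => g (iter T k ω) :=
    measurable_pi_lambda _ fun k => hg.comp (measurable_iter T k)
  have hmap := Measure.map_map (μ := P) hpath (measurable_iter T m)
  rw [(measurePreserving_iter hT m).map_eq] at hmap
  simp only [hmap, Function.comp_def, iter_add_apply]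

lemma stationaryMartingaleDifferences_iter [IsFiniteMeasure P] (hT : MeasurePreserving T P P)
    (hle : ℱ₀ ≤ mΩ) (hℱ : ℱ₀ ≤ ℱ₀.comap T) {g : Ω → ℝ} (hg : Measurable[ℱ₀] g) (hg2 : MemLp g 2 P)
    (hg0 : P[g ∘ T | ℱ₀] =ᵐ[P] 0) :
    StationaryMartingaleDifferences P (shiftFiltration T ℱ₀ hle hℱ)
      fun k ω => (g ∘ T) (iter T k ω) where
  measurable k := by
    change Measurable[ℱ₀.comap (iter T (k + 1))] (g ∘ (T ∘ iter T k))
    rw [← iter_add_one]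
    exact hg.comp (comap_measurable _)
  memLp k := (hg2.comp_measurePreserving hT).comp_measurePreserving (measurePreserving_iter hT k)
  condExp_eq_zero k :=
    (condExp_comp_comap (measurePreserving_iter hT k) hle
      ((hg2.comp_measurePreserving hT).integrable one_le_two)).trans
      ((measurePreserving_iter hT k).quasiMeasurePreserving.ae_eq_comp hg0)
  stationary := stationaryProcess_iter hT ((hg.mono hle le_rfl).comp T.measurable)

lemma StationaryMartingaleDifferences.martingale [IsFiniteMeasure P] {ℱ : Filtration ℤ mΩ}
    {D : ℤ → Ω → ℝ} (h : StationaryMartingaleDifferences P ℱ D) :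
    Martingale (partialSum D) (nonnegTimes ℱ) P := by
  refine martingale_of_condExp_sub_eq_zero_nat (fun n => ?_) (fun n => ?_) fun n => ?_
  · refine Measurable.stronglyMeasurable (Finset.measurable_fun_sum _ fun i hi => ?_)
    exact (h.measurable i).mono (ℱ.mono (by exact_mod_cast Finset.mem_range.1 hi)) le_rfl
  · exact integrable_finsetSum (Finset.range n) (f := fun (i : ℕ) ω => D i ω)
      fun i _ => (h.memLp i).integrable one_le_two
  · have hincr : partialSum D (n + 1) - partialSum D n = D n := by
      funext ω
      simp [partialSum, Finset.sum_range_succ]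
    rw [hincr]
    exact h.condExp_eq_zero n

lemma exists_integral_sq_birkhoffSum_sub_comp_le [IsFiniteMeasure P]
    (hT : MeasurePreserving T P P) (hle : ℱ₀ ≤ mΩ) (hℱ : ℱ₀ ≤ ℱ₀.comap T) {X₀ : Ω → ℝ}
    (hXm : Measurable[ℱ₀] X₀) (hX2 : MemLp X₀ 2 P)
    (hfin : projTail P ℱ₀ (fun i ω => X₀ (iter T i ω)) 1 ≠ ∞)
    (hlim : Tendsto (fun s => (projTail P ℱ₀ (fun i ω => X₀ (iter T i ω)) (2 ^ s)).toReal)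
      atTop (𝓝 0)) :
    ∃ g : Ω → ℝ, Measurable[ℱ₀] g ∧ MemLp g 2 P ∧ P[g ∘ T | ℱ₀] =ᵐ[P] 0 ∧
      ∀ s, ∫ ω, birkhoffSum T (X₀ - g ∘ T) (2 ^ s) ω ^ 2 ∂P ≤
        144 ^ 2 * 2 ^ s * (projTail P ℱ₀ (fun i ω => X₀ (iter T i ω)) (2 ^ s)).toReal ^ 2 := by
  have hfact : Fact (ℱ₀ ≤ mΩ) := ⟨hle⟩
  have hxX : hX2.toLp X₀ =ᵐ[P] X₀ := hX2.coeFn_toLp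
  obtain ⟨z, hzK, hz0, hz⟩ := exists_norm_orbitSum_sub_apply_le (lpMeas_le_map_koopman hT hℱ)
    (mem_lpMeas_iff_aestronglyMeasurable.2 ⟨X₀, hXm.stronglyMeasurable, hxX⟩)
    (isDyadicTailBound_projTail
      (fun k => by rw [partialSum_iter]; exact orbitSum_koopman_coeFn hT hxX k) hfin) hlim
  obtain ⟨g, hg, hzg⟩ := mem_lpMeas_iff_aestronglyMeasurable.1 hzK
  have hVz : koopman hT z =ᵐ[P] g ∘ T := koopman_coeFn hT hzg
  refine ⟨g, hg.measurable, (memLp_congr_ae hzg).1 (Lp.memLp z), ?_, fun s => ?_⟩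
  · refine (starProjection_lpMeas_coeFn hVz).symm.trans ?_
    rw [hz0]
    exact Lp.coeFn_zero ℝ 2 P
  · have hdiff : hX2.toLp X₀ - koopman hT z =ᵐ[P] X₀ - g ∘ T :=
      (Lp.coeFn_sub _ _).trans (hxX.sub hVz)
    rw [← norm_sq_eq_integral_sq (orbitSum_koopman_coeFn hT hdiff (2 ^ s)),
      ← sqrt_two_pow_mul_self]
    exact (pow_le_pow_left₀ (norm_nonneg _) (hz s) 2).trans_eq (by ring)

theorem exists_isMartingaleApproximation_iter [IsProbabilityMeasure P]
    (hb_pos : ∀ n : ℕ, 1 ≤ n → 0 < b n) (hb_mono : ∀ m n : ℕ, 1 ≤ m → m ≤ n → b m ≤ b n)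
    (hT : MeasurePreserving T P P) (hle : ℱ₀ ≤ mΩ) (hℱ : ℱ₀ ≤ ℱ₀.comap T) {X₀ : Ω → ℝ}
    (hXm : Measurable[ℱ₀] X₀) (hX2 : MemLp X₀ 2 P)
    (hcond : ProjectiveCondition P ℱ₀ (fun i ω => X₀ (iter T i ω)) b) :
    ∃ D : ℤ → Ω → ℝ, (∀ (k : ℤ) (ω : Ω), D k ω = D 0 (iter T k ω)) ∧
      IsMartingaleApproximation P (shiftFiltration T ℱ₀ hle hℱ)
        (fun i ω => X₀ (iter T i ω)) b D := by
  have hsum := hcond.summable_dyadicWeight hb_pos hb_mono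
  obtain ⟨g, hgm, hg2, hg0, hg⟩ := exists_integral_sq_birkhoffSum_sub_comp_le hT hle hℱ hXm hX2
    (hcond.projTail_ne_top (hb_pos 1 le_rfl) le_rfl)
    (tendsto_zero_of_summable_dyadicWeight_mul_sq hb_pos hb_mono hsum)
  have hD := stationaryMartingaleDifferences_iter hT hle hℱ hgm hg2 hg0
  refine ⟨_, fun k ω => by rw [iter_zero, id], hD, hD.martingale, ?_⟩
  have hsum' : Summable fun j : ℕ =>
      dyadicWeight b j / 2 ^ j * ∫ ω, birkhoffSum T (X₀ - g ∘ T) (2 ^ j) ω ^ 2 ∂P := by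
    have hw := dyadicWeight_pos hb_pos
    refine (hsum.mul_left (144 ^ 2)).of_nonneg_of_le (fun j => mul_nonneg
      (div_nonneg (hw j).le (by positivity)) (integral_nonneg fun _ => sq_nonneg _)) fun j => ?_
    refine (mul_le_mul_of_nonneg_left (hg j)
      (div_nonneg (hw j).le (by positivity))).trans_eq ?_
    field_simp
  filter_upwards [ae_tendsto_birkhoffSum_div_sqrt hT
    ((hXm.mono hle le_rfl).sub ((hgm.mono hle le_rfl).comp T.measurable))
    (hX2.sub (hg2.comp_measurePreserving hT)) (dyadicWeight_pos hb_pos)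
    (fun r n => sum_inv_dyadicWeight_le_bStar hb_pos hb_mono) hsum'] with ω hω
  refine hω.congr fun n => ?_
  rw [partialSum_iter, partialSum_iter, birkhoffSum_sub]

end Transformation

section Factor

variable {Ω Ω' : Type*} {mΩ : MeasurableSpace Ω} {m mΩ' : MeasurableSpace Ω'} {P : Measure Ω}
  {P' : Measure Ω'} [IsFiniteMeasure P] [IsFiniteMeasure P'] {φ : Ω → Ω'} {X : ℤ → Ω → ℝ}
  {X' : ℤ → Ω' → ℝ}

lemma projTail_comap (hφ : MeasurePreserving φ P P') (hm : m ≤ mΩ')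
    (hint : ∀ i, Integrable (X' i) P') (hX : ∀ᵐ ω ∂P, ∀ i, X i ω = X' i (φ ω)) :
    projTail P (m.comap φ) X = projTail P' m X' := by
  have hcond : ∀ k, P[partialSum X k | m.comap φ] =ᵐ[P] P'[partialSum X' k | m] ∘ φ := by
    intro k
    have hsum : partialSum X k =ᵐ[P] partialSum X' k ∘ φ := by
      filter_upwards [hX] with ω hω using Finset.sum_congr rfl fun i _ => hω i
    exact (condExp_congr_ae hsum).trans (condExp_comp_comap hφ hm
      (integrable_finsetSum (Finset.range k) (f := fun (i : ℕ) ω => X' i ω) fun i _ => hint i))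
  have hnorm : ∀ k, eLpNorm (P[partialSum X k | m.comap φ]) 2 P =
      eLpNorm (P'[partialSum X' k | m]) 2 P' := fun k => by
    rw [eLpNorm_congr_ae (hcond k), eLpNorm_comp_measurePreserving
      (stronglyMeasurable_condExp.mono hm).aestronglyMeasurable hφ]
  funext n
  simp only [projTail, hnorm]

variable {ℱ : Filtration ℤ mΩ} {ℱ' : Filtration ℤ mΩ'} {D : ℤ → Ω' → ℝ}

lemma StationaryMartingaleDifferences.comp_measurePreserving
    (hD : StationaryMartingaleDifferences P' ℱ' D) (hφ : MeasurePreserving φ P P')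
    (hℱ : ∀ k, (ℱ' k).comap φ = ℱ k) :
    StationaryMartingaleDifferences P ℱ fun k ω => D k (φ ω) where
  measurable k := by
    rw [← hℱ]
    exact (hD.measurable k).comp (comap_measurable φ)
  memLp k := (hD.memLp k).comp_measurePreserving hφ
  condExp_eq_zero k := by
    rw [← hℱ]
    exact (condExp_comp_comap hφ (ℱ'.le k) ((hD.memLp k).integrable one_le_two)).trans
      (hφ.quasiMeasurePreserving.ae_eq_comp (hD.condExp_eq_zero k))
  stationary j := by
    have hDm : ∀ k, Measurable (D k) := fun k => (hD.measurable k).mono (ℱ'.le _) le_rfl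
    have hlaw := hD.stationary j
    rw [← hφ.map_eq, Measure.map_map (measurable_pi_lambda _ fun k => hDm (k + j)) hφ.measurable,
      Measure.map_map (measurable_pi_lambda _ hDm) hφ.measurable] at hlaw
    exact hlaw

lemma IsMartingaleApproximation.comp_measurePreserving {b : ℕ → ℝ}
    (hD : IsMartingaleApproximation P' ℱ' X' b D) (hφ : MeasurePreserving φ P P')
    (hℱ : ∀ k, (ℱ' k).comap φ = ℱ k) (hX : ∀ᵐ ω ∂P, ∀ i, X i ω = X' i (φ ω)) :
    IsMartingaleApproximation P ℱ X b fun k ω => D k (φ ω) := by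
  have hdiff := hD.1.comp_measurePreserving hφ hℱ
  refine ⟨hdiff, hdiff.martingale, ?_⟩
  filter_upwards [hφ.quasiMeasurePreserving.ae hD.2.2, hX] with ω hlim hω
  simpa only [partialSum, hω] using hlim

end Factor

section PathSpace

variable {S : Type*} [mS : MeasurableSpace S]

/-- The shift on the space of two-sided paths. -/
def pathShift (S : Type*) [MeasurableSpace S] : (ℤ → S) ≃ᵐ (ℤ → S) where
  toFun x k := x (k + 1)
  invFun x k := x (k - 1)
  left_inv x := by simp
  right_inv x := by simp
  measurable_toFun := measurable_pi_lambda _ fun k => measurable_pi_apply (k + 1)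
  measurable_invFun := measurable_pi_lambda _ fun k => measurable_pi_apply (k - 1)

lemma pathShift_apply (x : ℤ → S) (k : ℤ) : pathShift S x k = x (k + 1) := rfl

lemma pathShift_symm_apply (x : ℤ → S) (k : ℤ) : (pathShift S).symm x k = x (k - 1) := rfl

lemma iter_pathShift_apply (m : ℤ) (x : ℤ → S) (k : ℤ) :
    iter (pathShift S) m x k = x (k + m) := by
  induction m using Int.induction_on generalizing k with
  | zero => rw [iter_zero, id, add_zero]
  | succ i ih =>
    rw [iter_add_one, Function.comp_apply, pathShift_apply, ih, add_right_comm, ← add_assoc]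
  | pred i ih =>
    rw [iter_sub_one, Function.comp_apply, pathShift_symm_apply, ih, sub_add_eq_add_sub,
      ← add_sub_assoc]

/-- The filtration of the coordinate process on the space of two-sided paths. -/
abbrev pathPast (S : Type*) [MeasurableSpace S] :
    Filtration (Ω := ℤ → S) ℤ MeasurableSpace.pi :=
  pastFiltration (fun i (x : ℤ → S) => x i) measurable_pi_apply

lemma comap_iter_pathPast (k : ℤ) :
    (pathPast S 0).comap (iter (pathShift S) k) = pathPast S k := by
  change (⨆ (i : ℤ) (_ : i ≤ 0), mS.comap fun x : ℤ → S => x i).comap _ =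
    ⨆ (i : ℤ) (_ : i ≤ k), mS.comap fun x : ℤ → S => x i
  simp only [MeasurableSpace.comap_iSup, MeasurableSpace.comap_comp, Function.comp_def,
    iter_pathShift_apply]
  refine le_antisymm (iSup₂_le fun i hi => ?_) (iSup₂_le fun i hi => ?_)
  · exact le_iSup₂_of_le (i + k) (by omega) le_rfl
  · exact le_iSup₂_of_le (i - k) (by omega) (by rw [sub_add_cancel])

lemma pathPast_zero_le_comap : pathPast S 0 ≤ (pathPast S 0).comap (pathShift S) := by
  have hone : iter (pathShift S) 1 = pathShift S := by
    rw [← zero_add 1, iter_add_one, iter_zero, Function.comp_id]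
  rw [← hone, comap_iter_pathPast]
  exact (pathPast S).mono zero_le_one

variable {Ω : Type*} {mΩ : MeasurableSpace Ω} {P : Measure Ω} {ξ : ℤ → Ω → S}

lemma measurable_pastFiltration (hξ : ∀ i, Measurable (ξ i)) {i k : ℤ} (hik : i ≤ k) :
    Measurable[pastFiltration ξ hξ k] (ξ i) :=
  (comap_measurable (ξ i)).mono
    (le_iSup₂_of_le (f := fun (i : ℤ) (_ : i ≤ k) => mS.comap (ξ i)) i hik le_rfl) le_rfl

lemma comap_pathPast (hξ : ∀ i, Measurable (ξ i)) (k : ℤ) :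
    (pathPast S k).comap (fun ω i => ξ i ω) = pastFiltration ξ hξ k := by
  change (⨆ (i : ℤ) (_ : i ≤ k), mS.comap fun x : ℤ → S => x i).comap _ = _
  simp only [MeasurableSpace.comap_iSup, MeasurableSpace.comap_comp]
  rfl

lemma StationaryProcess.measurePreserving_pathShift (h : StationaryProcess P ξ)
    (hξ : ∀ i, Measurable (ξ i)) :
    MeasurePreserving (pathShift S) (P.map fun ω i => ξ i ω) (P.map fun ω i => ξ i ω) := by
  refine ⟨(pathShift S).measurable, ?_⟩
  rw [Measure.map_map (pathShift S).measurable (measurable_pi_lambda _ hξ)]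
  exact h 1

lemma StationaryProcess.map_apply_eq (h : StationaryProcess P ξ) (hξ : ∀ i, Measurable (ξ i))
    (i : ℤ) : P.map (ξ i) = P.map (ξ 0) := by
  have hlaw := congrArg (Measure.map fun x : ℤ → S => x 0) (h i)
  rw [Measure.map_map (measurable_pi_apply 0) (measurable_pi_lambda _ fun k => hξ (k + i)),
    Measure.map_map (measurable_pi_apply 0) (measurable_pi_lambda _ hξ)] at hlaw
  simpa only [Function.comp_def, zero_add] using hlaw

theorem exists_isMartingaleApproximation_of_stationaryProcess [IsProbabilityMeasure P] {b : ℕ → ℝ}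
    (hb_pos : ∀ n : ℕ, 1 ≤ n → 0 < b n) (hb_mono : ∀ m n : ℕ, 1 ≤ m → m ≤ n → b m ≤ b n)
    (hξ : ∀ i, Measurable (ξ i)) (hstat : StationaryProcess P ξ) {f : S → ℝ}
    (hf : MemLp f 2 (P.map (ξ 0)))
    (hcond : ProjectiveCondition P (pastFiltration ξ hξ 0) (fun i ω => f (ξ i ω)) b) :
    ∃ D : ℤ → Ω → ℝ, IsMartingaleApproximation P (pastFiltration ξ hξ)
      (fun i ω => f (ξ i ω)) b D := by
  have hpath : MeasurePreserving (fun ω i => ξ i ω) P (P.map fun ω i => ξ i ω) :=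
    (measurable_pi_lambda _ hξ).measurePreserving P
  have hprob := Measure.isProbabilityMeasure_map (μ := P) hpath.aemeasurable
  have hT := hstat.measurePreserving_pathShift hξ
  obtain ⟨f', hf'm, hff'⟩ := hf.1
  have hX₀m : Measurable[pathPast S 0] fun x : ℤ → S => f' (x 0) :=
    hf'm.measurable.comp (measurable_pastFiltration measurable_pi_apply le_rfl)
  have hX₀2 : MemLp (fun x : ℤ → S => f' (x 0)) 2 (P.map fun ω i => ξ i ω) := by
    have hcoord := (measurable_pi_apply 0).measurePreserving (P.map fun ω i => ξ i ω)
    rw [Measure.map_map (measurable_pi_apply 0) hpath.measurable] at hcoord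
    exact ((memLp_congr_ae hff').1 hf).comp_measurePreserving hcoord
  have hX : ∀ᵐ ω ∂P, ∀ i, f (ξ i ω) = f' (iter (pathShift S) i (fun i => ξ i ω) 0) := by
    refine ae_all_iff.2 fun i => ?_
    simp only [iter_pathShift_apply, zero_add]
    exact ae_of_ae_map (hξ i).aemeasurable (by rwa [hstat.map_apply_eq hξ i])
  have htail := projTail_comap hpath ((pathPast S).le 0)
    (fun i => (hX₀2.comp_measurePreserving (measurePreserving_iter hT i)).integrable one_le_two) hX
  rw [comap_pathPast hξ] at htail
  rw [ProjectiveCondition, htail] at hcond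
  obtain ⟨D, -, hD⟩ := exists_isMartingaleApproximation_iter hb_pos hb_mono hT
    ((pathPast S).le 0) pathPast_zero_le_comap hX₀m hX₀2 hcond
  refine ⟨_, hD.comp_measurePreserving hpath (fun k => ?_) hX⟩
  rw [← comap_pathPast hξ k, ← comap_iter_pathPast k]
  rfl

end PathSpace

end MartApprox

theorem mainTheorem2_general {Ω : Type*} [mΩ : MeasurableSpace Ω] (P : Measure Ω)
    [IsProbabilityMeasure P] (b : ℕ → ℝ)
    (hb_pos : ∀ n : ℕ, 1 ≤ n → 0 < b n)
    (hb_mono : ∀ m n : ℕ, 1 ≤ m → m ≤ n → b m ≤ b n) :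
    (∀ (S : Type*) [MeasurableSpace S] (ξ : ℤ → Ω → S) (hξ : ∀ i, Measurable (ξ i)) (f : S → ℝ),
      MartApprox.StationaryProcess P ξ → MemLp f 2 (P.map (ξ 0)) →
      MartApprox.ProjectiveCondition P (MartApprox.pastFiltration ξ hξ 0)
        (fun i ω => f (ξ i ω)) b →
      ∃ D : ℤ → Ω → ℝ, MartApprox.IsMartingaleApproximation P (MartApprox.pastFiltration ξ hξ)
        (fun i ω => f (ξ i ω)) b D) ∧
    (∀ (T : Ω ≃ᵐ Ω), MeasurePreserving T P P →
      ∀ (ℱ₀ : MeasurableSpace Ω) (hle : ℱ₀ ≤ mΩ) (hT : ℱ₀ ≤ ℱ₀.comap T) (X₀ : Ω → ℝ),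
      Measurable[ℱ₀] X₀ → MemLp X₀ 2 P →
      MartApprox.ProjectiveCondition P ℱ₀ (fun i ω => X₀ (MartApprox.iter T i ω)) b →
      ∃ D : ℤ → Ω → ℝ, (∀ (k : ℤ) (ω : Ω), D k ω = D 0 (MartApprox.iter T k ω)) ∧
        MartApprox.IsMartingaleApproximation P (MartApprox.shiftFiltration T ℱ₀ hle hT)
          (fun i ω => X₀ (MartApprox.iter T i ω)) b D) :=
  ⟨fun _ _ _ hξ _ hstat hf =>
    MartApprox.exists_isMartingaleApproximation_of_stationaryProcess hb_pos hb_mono hξ hstat hf,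
  fun _ hT _ hle hℱ _ hXm hX2 =>
    MartApprox.exists_isMartingaleApproximation_iter hb_pos hb_mono hT hle hℱ hXm hX2⟩

theorem mainTheorem2 {Ω : Type*} [mΩ : MeasurableSpace Ω] (P : Measure Ω)
    [IsProbabilityMeasure P] (b : ℕ → ℝ)
    (hb_pos : ∀ n : ℕ, 1 ≤ n → 0 < b n)
    (hb_mono : ∀ m n : ℕ, 1 ≤ m → m ≤ n → b m ≤ b n)
    (hb_slow : MartApprox.SlowlyVarying b) :
    -- stationary Markov chains
    (∀ (S : Type*) [MeasurableSpace S] (Q : Kernel S S) [IsMarkovKernel Q]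
      (ξ : ℤ → Ω → S) (hξ : ∀ i, Measurable (ξ i)) (f : S → ℝ),
      MartApprox.StationaryMarkovChain P Q ξ hξ →
      MemLp f 2 (P.map (ξ 0)) → ∫ x, f x ∂(P.map (ξ 0)) = 0 →
      MartApprox.ProjectiveCondition P (MartApprox.pastFiltration ξ hξ 0)
        (fun i ω => f (ξ i ω)) b →
      ∃ D : ℤ → Ω → ℝ, MartApprox.IsMartingaleApproximation P (MartApprox.pastFiltration ξ hξ)
        (fun i ω => f (ξ i ω)) b D) ∧
    -- processes generated by an invertible measure preserving transformation
    (∀ (T : Ω ≃ᵐ Ω), MeasurePreserving T P P →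
      ∀ (ℱ₀ : MeasurableSpace Ω) (hle : ℱ₀ ≤ mΩ) (hT : ℱ₀ ≤ ℱ₀.comap T) (X₀ : Ω → ℝ),
      Measurable[ℱ₀] X₀ → MemLp X₀ 2 P → ∫ ω, X₀ ω ∂P = 0 →
      MartApprox.ProjectiveCondition P ℱ₀ (fun i ω => X₀ (MartApprox.iter T i ω)) b →
      ∃ D : ℤ → Ω → ℝ, (∀ (k : ℤ) (ω : Ω), D k ω = D 0 (MartApprox.iter T k ω)) ∧
        MartApprox.IsMartingaleApproximation P (MartApprox.shiftFiltration T ℱ₀ hle hT)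
          (fun i ω => X₀ (MartApprox.iter T i ω)) b D) := by
  obtain ⟨process_case, transformation_case⟩ := mainTheorem2_general P b hb_pos hb_mono
  exact ⟨fun S _ _ _ ξ hξ f hchain hf _ => process_case S ξ hξ f hchain.stationary hf,
    fun T hT ℱ₀ hle hℱ X₀ hXm hX2 _ => transformation_case T hT ℱ₀ hle hℱ X₀ hXm hX2⟩
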